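/- Let $d>2$ and identify $L(\mathbb{C}^2\otimes\mathbb{C}^d)$ with the $2d\times 2d$ complex matrices $X=[X_{ij}]_{i,j=1,2}$ with blocks $X_{ij}$ of size $d\times d$ (standard basis ordered lexicographically). Write $\operatorname{tr}_1[X]=X_{11}+X_{22}\in L(\mathbb{C}^d)$ and $\operatorname{tr}_2[X]=(\operatorname{tr}[X_{ij}])_{i,j}\in L(\mathbb{C}^2)$ for the partial traces and, for self-adjoint $X$, let $\lambda^{(1,2)}(X)=\lambda(\operatorname{tr}_1[X]\oplus\operatorname{tr}_2[X])\in\mathbb{R}^{d+2}$ be the vector of eigenvalues, with multiplicity, of the direct sum of the partial traces. For $x,y\in\mathbb{R}^n$ let $x\preceq y$ denote majorization: for every $k\le n$ the sum of the $k$ largest entries of $x$ is at most the sum of the $k$ largest entries of $y$, and $\sum_i x_i=\sum_i y_i$. **Theorem.** Let $C\in L(\mathbb{C}^2\otimes\mathbb{C}^d)$ be positive semidefinite with eigenvalues $\lambda_1\ge\lambda_2\ge\dots\ge\lambda_{2d}$, let $\Lambda=\operatorname{diag}(\lambda_1,\dots,\lambda_{2d})$ and, for $\pi\in S_{2d}$,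 $\Lambda_\pi=\operatorname{diag}(\lambda_{\pi(1)},\dots,\lambda_{\pi(2d)})$. Then for every unitary $U$ on $\mathbb{C}^2\otimes\mathbb{C}^d$ there exists $\pi\in S_{2d}$ such that $$\lambda^{(1,2)}(UCU^*)\preceq\lambda^{(1,2)}(\Lambda_\pi)$$ if and only if one of the following holds: 1. $\operatorname{rank}(C)\le 3$; 2. $\operatorname{rank}(C)\in\{2d-1,2d\}$ and $\lambda_2=\dots=\lambda_{2d-1}$; 3. $\operatorname{rank}(C)\in\{2d-1,2d\}$, $\lambda_3=\dots=\lambda_{2d-1}$ and $\lambda_2\ge 2(d-2)\lambda_3+\lambda_{2d}$; 4. $d=3$, $\operatorname{rank}(C)=5$ and $\lambda_3=\lambda_4=\lambda_5$. Moreover, in each of the cases 1, 2 and 4 one has $\lambda^{(1,2)}(UCU^*)\preceq\lambda^{(1,2)}(\Lambda)$ for every unitary $U$; and in case 3, for every unitary $U$, at least one of $\lambda^{(1,2)}(UCU^*)\preceq\lambda^{(1,2)}(\Lambda)$ and $\lambda^{(1,2)}(UCU^*)\preceq\lambda^{(1,2)}(P\Lambda P)$ holds, where $P=P_{2,d+1}$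 is the permutation matrix that exchanges the entries $2$ and $d+1$. -/

import Mathlib

open Matrix
open scoped ComplexOrder

noncomputable section

/-- First partial trace of an operator on `ℂ^m ⊗ ℂ^n` (traces out the first factor):
the sum of the diagonal blocks. -/
def ptrace₁ {m n : Type*} [Fintype m] (X : Matrix (m × n) (m × n) ℂ) : Matrix n n ℂ :=
  Matrix.of fun s t => ∑ i, X (i, s) (i, t)

/-- Second partial trace of an operator on `ℂ^m ⊗ ℂ^n` (traces out the second factor):
the matrix of the traces of the blocks. -/
def ptrace₂ {m n : Type*} [Fintype n] (X : Matrix (m × n) (m × n) ℂ) : Matrix m m ℂ :=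
  Matrix.of fun i j => ∑ s, X (i, s) (j, s)

/-- The direct sum `tr₁ X ⊕ tr₂ X`. -/
def ptraceSum {m n : Type*} [Fintype m] [Fintype n] (X : Matrix (m × n) (m × n) ℂ) :
    Matrix (n ⊕ m) (n ⊕ m) ℂ :=
  Matrix.fromBlocks (ptrace₁ X) 0 0 (ptrace₂ X)

theorem ptraceSum_isHermitian {m n : Type*} [Fintype m] [Fintype n]
    {X : Matrix (m × n) (m × n) ℂ} (hX : X.IsHermitian) : (ptraceSum X).IsHermitian := by
  refine Matrix.IsHermitian.fromBlocks ?_ (by simp) ?_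
  · ext s t
    simp [ptrace₁, hX.apply]
  · ext i j
    simp [ptrace₂, hX.apply]

/-- `specPtraceSum X hX` is the vector `λ(tr₁ X ⊕ tr₂ X)` of the eigenvalues (with multiplicity)
of `tr₁ X ⊕ tr₂ X`, for a self-adjoint `X`. -/
def specPtraceSum {m n : Type*} [Fintype m] [Fintype n] [DecidableEq m] [DecidableEq n]
    (X : Matrix (m × n) (m × n) ℂ) (hX : X.IsHermitian) : Fin (Fintype.card (n ⊕ m)) → ℝ :=
  (ptraceSum_isHermitian hX).eigenvalues₀

/-- `eig A hA k` is the `k`-th largest eigenvalue (counted with multiplicity, `k = 1, 2, …`) of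
the self-adjoint matrix `A`; the value outside the range `1 ≤ k ≤ size of A` is irrelevant. -/
def eig {n : Type*} [Fintype n] [DecidableEq n] (A : Matrix n n ℂ) (hA : A.IsHermitian)
    (k : ℕ) : ℝ :=
  if h : 1 ≤ k ∧ k ≤ Fintype.card n then hA.eigenvalues₀ ⟨k - 1, by omega⟩ else 0

/-- The diagonal matrix `Λ_π` of the eigenvalues of `C`, `(Λ_π)_{kk} = λ_{π(k)}`. The standard
basis is ordered lexicographically: the pair `(i, s)` (counted from `0`) has position
`d * i + s`. -/
def diagEig {d : ℕ} (C : Matrix (Fin 2 × Fin d) (Fin 2 × Fin d) ℂ) (hC : C.IsHermitian)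
    (π : Equiv.Perm (Fin (2 * d))) : Matrix (Fin 2 × Fin d) (Fin 2 × Fin d) ℂ :=
  Matrix.diagonal fun p => ((eig C hC ((π (finProdFinEquiv p) : ℕ) + 1) : ℝ) : ℂ)

theorem diagEig_isHermitian {d : ℕ} {C : Matrix (Fin 2 × Fin d) (Fin 2 × Fin d) ℂ}
    (hC : C.IsHermitian) (π : Equiv.Perm (Fin (2 * d))) : (diagEig C hC π).IsHermitian := by
  refine Matrix.isHermitian_diagonal_of_self_adjoint _ ?_
  ext p
  simp

/-- The permutation matrix `P_{2,d+1}` on `ℂ^2 ⊗ ℂ^d`: it exchanges the second and the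
`(d+1)`-st vector of the lexicographically ordered standard basis. -/
def swapP (d : ℕ) (hd : 2 < d) : Matrix (Fin 2 × Fin d) (Fin 2 × Fin d) ℂ :=
  Matrix.swap ℂ (finProdFinEquiv.symm ⟨1, by omega⟩) (finProdFinEquiv.symm ⟨d, by omega⟩)

theorem swapP_mul_mul_isHermitian {d : ℕ} (hd : 2 < d)
    {X : Matrix (Fin 2 × Fin d) (Fin 2 × Fin d) ℂ} (hX : X.IsHermitian) :
    (swapP d hd * X * swapP d hd).IsHermitian := by
  have h : (swapP d hd)ᴴ = swapP d hd := by
    simp [swapP, Matrix.swap]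
  have := Matrix.isHermitian_mul_mul_conjTranspose (swapP d hd) hX
  rwa [h] at this

/-- The decreasing rearrangement `x↓` of a real vector `x`. -/
def decreasing {N : ℕ} (x : Fin N → ℝ) : Fin N → ℝ :=
  x ∘ Tuple.sort (fun i => -x i)

/-- Majorization `x ≼ y` of real vectors: the sum of the `k` largest entries of `x` is at most
the sum of the `k` largest entries of `y` for every `k`, and the total sums are equal. -/
def Majorizes {N : ℕ} (x y : Fin N → ℝ) : Prop :=
  (∀ k ≤ N, ∑ i with i.val < k, decreasing x i ≤ ∑ i with i.val < k, decreasing y i) ∧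
    ∑ i, x i = ∑ i, y i

infix:50 " ≼ₘ " => Majorizes

end

/-! The problem reduces to `2 × d` arrays of real numbers. In a product of eigenbases of the two
partial traces, the eigenvalues of the partial traces are the column and row sums of the diagonal of
the operator (`exists_unitary_charpoly_ptraceSum`). By Schur, this diagonal is majorized by the
spectrum (`sum_diag_conj_le`). Conversely, a reflection mixing two cells that share neither row nor
column keeps both partial traces diagonal, so it realizes a transfer of mass between these cells
(`exists_conj_of_transfer`). Below, `f i` is the eigenvalue `λ_{i+1}` and `P k` is the sum of the
`k` largest ones.

Sufficiency. For `k` columns and one row of an array majorized by `f`, inclusion–exclusion gives the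
bound `P k + P (d + k)`, which the sorted array attains. Columns alone are handled by comparison
with a row and one column fewer, so only selections containing both rows can obstruct
(`dominated_arrangement_one`). If `f` is constant on a long range, `P` is affine there and this
obstruction vanishes, except for a single column when the range starts at index 2. In case 3 that
column is handled by a dichotomy: either no row exceeds `P 2`, and the array with the two largest
entries in one column dominates, or some row exceeds `P 2`, which forces every column to be small.

Necessity. Each excluded spectrum is refuted by one transfer. A row sum above `P 2` can be matched
only by a row of the dominating arrangement; that row must then contain almost all the large
eigenvalues, and a second family of lines gives the contradiction. This excludes ranks from 4 to `d`
(`not_forall_dominated_of_rank_le`), makes `f` constant from index `d - 1` to `2d - 2` when the rank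
exceeds `d` (`arrangement_const_of_forall_dominated`), and extends this plateau to the left
(`not_forall_dominated_of_const`). The strict inequalities needed in the last step fail exactly in
the listed cases. -/

/-! ### Majorization in terms of sums over subsets. -/

theorem decreasing_eq_self {N : ℕ} {x : Fin N → ℝ} (hx : Antitone x) : decreasing x = x := by
  have h : Tuple.sort (fun i => -x i) = Equiv.refl _ :=
    Tuple.sort_eq_refl_iff_monotone.2 fun i j hij => neg_le_neg (hx hij)
  simp [decreasing, h]

/-- A weighted sum of a nonincreasing sequence with weights in `[0, 1]` of total weight `k` is at
most the sum of the first `k` terms. -/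
theorem sum_weight_mul_le {N k : ℕ} {f : ℕ → ℝ} (hf : Antitone f) (hk : k ≤ N) (w : Fin N → ℝ)
    (h0 : ∀ i, 0 ≤ w i) (h1 : ∀ i, w i ≤ 1) (hw : ∑ i, w i = k) :
    ∑ i, w i * f i ≤ ∑ i ∈ Finset.range k, f i := by
  have e1 (g : ℕ → ℝ) : ∑ i ∈ Finset.range k, g i = ∑ i : Fin N, if i.val < k then g i else 0 := by
    rw [Fin.sum_univ_eq_sum_range (fun i => if i < k then g i else 0), ← Finset.sum_filter]
    congr 1
    ext i
    simp only [Finset.mem_range, Finset.mem_filter]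
    omega
  have e2 : ∑ i : Fin N, (if i.val < k then (1 : ℝ) else 0) = k := by
    rw [← e1 (fun _ => 1)]; simp
  -- The weight difference is nonpositive for `i < k` and nonnegative afterwards, so replacing `f i`
  -- by `f k` can only increase each term; the differences add up to zero.
  have key : ∀ i : Fin N, (w i - if i.val < k then (1 : ℝ) else 0) * f i ≤
      (w i - if i.val < k then (1 : ℝ) else 0) * f k := by
    intro i
    split_ifs with h
    · exact mul_le_mul_of_nonpos_left (hf h.le) (by linarith [h1 i])
    · exact mul_le_mul_of_nonneg_left (hf (not_lt.1 h)) (by linarith [h0 i])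
  have := Finset.sum_le_sum fun i (_ : i ∈ Finset.univ) => key i
  rw [← Finset.sum_mul, Finset.sum_sub_distrib, hw, e2, sub_self, zero_mul] at this
  simp only [sub_mul, ite_mul, one_mul, zero_mul, Finset.sum_sub_distrib] at this
  rw [e1]
  linarith

/-- The maximum of a finite set of naturals is at least the number of its other elements, so
removing maxima one by one compares the sums term by term. -/
theorem sum_le_sum_range_card {f : ℕ → ℝ} (hf : Antitone f) (A : Finset ℕ) :
    ∑ i ∈ A, f i ≤ ∑ i ∈ Finset.range A.card, f i := by
  induction A using Finset.induction_on_max with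
  | empty => simp
  | insert a s ha ih =>
    have hs : a ∉ s := fun h => lt_irrefl _ (ha a h)
    have hc : s.card ≤ a := by
      simpa using Finset.card_le_card (fun x hx => Finset.mem_range.2 (ha x hx) : s ⊆ Finset.range a)
    rw [Finset.sum_insert hs, Finset.card_insert_of_notMem hs, Finset.sum_range_succ]
    linarith [hf hc]

/-- Majorization of nonincreasing vectors that are rearrangements of families `μ`, `ν`, in terms
of sums over subsets. -/
theorem majorizes_iff {ι : Type*} [Fintype ι] {N : ℕ} {v w : Fin N → ℝ} {μ ν : ι → ℝ}
    (hv : Antitone v) (hw : Antitone w) (hvμ : ∃ e : Fin N ≃ ι, ∀ k, v k = μ (e k))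
    (hwν : ∃ e : Fin N ≃ ι, ∀ k, w k = ν (e k)) :
    v ≼ₘ w ↔ (∀ S : Finset ι, ∃ S' : Finset ι, S'.card = S.card ∧
      ∑ i ∈ S, μ i ≤ ∑ i ∈ S', ν i) ∧ ∑ i, μ i = ∑ i, ν i := by
  classical
  have aux : ∀ {v : Fin N → ℝ} {μ : ι → ℝ}, Antitone v → ∀ e : Fin N ≃ ι, (∀ k, v k = μ (e k)) →
      (∑ i, v i = ∑ i, μ i) ∧ (∀ S : Finset ι, ∑ i ∈ S, μ i ≤ ∑ i with i.val < S.card, v i) ∧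
      ∀ k ≤ N, ∃ S : Finset ι, S.card = k ∧ ∑ i with i.val < k, v i = ∑ i ∈ S, μ i := by
    intro v μ hv e he
    refine ⟨by rw [← e.sum_comp]; simp [he], fun S => ?_, fun k hk => ?_⟩
    · set A : Finset (Fin N) := S.map e.symm.toEmbedding with hA
      have hAc : A.card = S.card := Finset.card_map _
      have hS : ∑ i ∈ S, μ i = ∑ i ∈ A, v i := by simp [hA, he]
      rw [hS, ← hAc]
      have hAN : A.card ≤ N := by simpa using A.card_le_univ
      rcases Nat.eq_zero_or_pos N with rfl | hN
      · simp [Finset.eq_empty_of_isEmpty]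
      -- Clamping the index extends `v` to a nonincreasing sequence on all of `ℕ`.
      let f : ℕ → ℝ := fun n => v ⟨min n (N - 1), by omega⟩
      have hf : Antitone f := fun a b hab => hv (by
        simp only [Fin.mk_le_mk]; omega)
      have hfv : ∀ i : Fin N, f i = v i := fun i => by
        simp only [f]; congr 1; ext; simp only; omega
      have := sum_le_sum_range_card hf (A.map Fin.valEmbedding)
      simp only [Finset.sum_map, Fin.valEmbedding_apply, hfv, Finset.card_map] at this
      refine this.trans (le_of_eq ?_)
      rw [Finset.sum_filter]
      simp_rw [← hfv]
      rw [Fin.sum_univ_eq_sum_range (fun i => if i < A.card then f i else 0), ← Finset.sum_filter]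
      congr 1
      ext i
      simp only [Finset.mem_range, Finset.mem_filter]
      omega
    · refine ⟨(Finset.univ.filter fun i : Fin N => i.val < k).map e.toEmbedding, ?_, ?_⟩
      · rw [Finset.card_map, Fin.card_filter_val_lt]; omega
      · simp [he]
  obtain ⟨e, he⟩ := hvμ
  obtain ⟨f, hf⟩ := hwν
  obtain ⟨v0, v1, v2⟩ := aux hv e he
  obtain ⟨w0, w1, w2⟩ := aux hw f hf
  have hcard : Fintype.card ι = N := by simp [← Fintype.card_congr e]
  rw [Majorizes, decreasing_eq_self hv, decreasing_eq_self hw, v0, w0]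
  refine and_congr_left fun _ => ⟨fun h S => ?_, fun h k hk => ?_⟩
  · have hS : S.card ≤ N := hcard ▸ S.card_le_univ
    obtain ⟨S', h1, h2⟩ := w2 _ hS
    exact ⟨S', h1, (v1 S).trans ((h _ hS).trans h2.le)⟩
  · obtain ⟨S, h1, h2⟩ := v2 k hk
    obtain ⟨S', h3, h4⟩ := h S
    rw [h2]
    exact h4.trans ((w1 S').trans (by rw [h3, h1]))

/-! ### Eigenvalues of the partial traces as row and column sums. -/

open Polynomial in
theorem exists_equiv_eigenvalues₀ {ι : Type*} [Fintype ι] [DecidableEq ι] {A : Matrix ι ι ℂ}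
    (hA : A.IsHermitian) {μ : ι → ℝ} (h : A.charpoly = ∏ i, (X - C (μ i : ℂ))) :
    ∃ e : Fin (Fintype.card ι) ≃ ι, ∀ k, hA.eigenvalues₀ k = μ (e k) := by
  have h1 : A.charpoly.roots = Multiset.map (fun i => (μ i : ℂ)) Finset.univ.val := by
    rw [h, Polynomial.roots_prod]
    · simp
    · simp [Finset.prod_ne_zero_iff, Polynomial.X_sub_C_ne_zero]
  have h2 : Multiset.map hA.eigenvalues₀ Finset.univ.val = Multiset.map μ Finset.univ.val := by
    apply Multiset.map_injective Complex.ofReal_injective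
    rw [hA.roots_charpoly_eq_eigenvalues₀] at h1
    rw [Multiset.map_map, Multiset.map_map]
    exact h1
  -- Equal multisets of values have fibres of equal cardinality; gluing bijections of the fibres
  -- gives the rearrangement.
  have h3 (c : ℝ) : Nonempty ({k // hA.eigenvalues₀ k = c} ≃ {i // μ i = c}) := by
    rw [← Fintype.card_eq, Fintype.card_subtype, Fintype.card_subtype]
    have := congrArg (Multiset.count c) h2
    rw [Multiset.count_map, Multiset.count_map] at this
    simpa only [Finset.card_def, Finset.filter_val, eq_comm] using this
  exact ⟨Equiv.ofFiberEquiv fun c => (h3 c).some,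
    fun k => (Equiv.ofFiberEquiv_map (fun c => (h3 c).some) k).symm⟩

/-- The column sums and the row sums of an array, as one family. -/
def lineSums {m n : Type*} [Fintype m] [Fintype n] (x : m × n → ℝ) : n ⊕ m → ℝ :=
  Sum.elim (fun s => ∑ i, x (i, s)) (fun i => ∑ s, x (i, s))

theorem sum_lineSums {m n : Type*} [Fintype m] [Fintype n] (x : m × n → ℝ) :
    ∑ e, lineSums x e = 2 * ∑ p, x p := by
  rw [Fintype.sum_sum_type, Fintype.sum_prod_type]
  simp only [lineSums, Sum.elim_inl, Sum.elim_inr]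
  rw [Finset.sum_comm]; ring

-- The partial trace is adjoint to `M ↦ 1 ⊗ M` under the trace pairing. This computes partial traces
-- after conjugation by a product unitary without expanding entries.
open scoped Kronecker in
theorem trace_mul_one_kronecker {m n : Type*} [Fintype m] [Fintype n] [DecidableEq m]
    (X : Matrix (m × n) (m × n) ℂ) (M : Matrix n n ℂ) :
    (X * ((1 : Matrix m m ℂ) ⊗ₖ M)).trace = (ptrace₁ X * M).trace := by
  simp only [trace, diag, mul_apply, kroneckerMap_apply, one_apply, ptrace₁, of_apply,
    Fintype.sum_prod_type, ite_mul, one_mul, zero_mul, mul_ite, mul_zero, Finset.sum_mul]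
  rw [Finset.sum_comm]
  refine Finset.sum_congr rfl fun s _ => ?_
  rw [Finset.sum_comm]
  simp only [Finset.sum_comm (s := (Finset.univ : Finset m)) (t := (Finset.univ : Finset n))]
  simp [Finset.sum_ite_eq]

open scoped Kronecker in
theorem trace_mul_kronecker_one {m n : Type*} [Fintype m] [Fintype n] [DecidableEq n]
    (X : Matrix (m × n) (m × n) ℂ) (M : Matrix m m ℂ) :
    (X * (M ⊗ₖ (1 : Matrix n n ℂ))).trace = (ptrace₂ X * M).trace := by
  simp only [trace, diag, mul_apply, kroneckerMap_apply, one_apply, ptrace₂, of_apply,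
    Fintype.sum_prod_type, mul_one, mul_ite, mul_zero, Finset.sum_mul]
  refine Finset.sum_congr rfl fun s _ => ?_
  rw [Finset.sum_comm]
  refine Finset.sum_congr rfl fun s _ => ?_
  simp [Finset.sum_ite_eq']

section

variable {n : Type*} [Fintype n] [DecidableEq n]

theorem star_eigenvectorUnitary_mul_mul {A : Matrix n n ℂ} (hA : A.IsHermitian) :
    (hA.eigenvectorUnitary : Matrix n n ℂ)ᴴ * A * (hA.eigenvectorUnitary : Matrix n n ℂ) =
      diagonal fun i => (hA.eigenvalues i : ℂ) := by
  have := hA.conjStarAlgAut_star_eigenvectorUnitary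
  rw [Unitary.conjStarAlgAut_star_apply] at this
  exact this

theorem eq_eigenvectorUnitary_mul_mul {A : Matrix n n ℂ} (hA : A.IsHermitian) :
    A = (hA.eigenvectorUnitary : Matrix n n ℂ) * (diagonal fun i => (hA.eigenvalues i : ℂ)) *
      (hA.eigenvectorUnitary : Matrix n n ℂ)ᴴ := by
  have := hA.spectral_theorem
  rw [Unitary.conjStarAlgAut_apply] at this
  exact this

theorem trace_mul_single_self (A : Matrix n n ℂ) (i : n) : (A * Matrix.single i i 1).trace = A i i := by
  simp [Matrix.trace_mul_single]

theorem mul_diagonal_mul_conjTranspose_apply (Q : Matrix n n ℂ) (f : n → ℝ) (p : n) :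
    ((Q * (diagonal fun i => (f i : ℂ)) * Qᴴ) p p) = ((∑ j, Complex.normSq (Q p j) * f j : ℝ) : ℂ) := by
  rw [mul_apply]
  simp only [mul_diagonal, conjTranspose_apply, RCLike.star_def]
  push_cast
  refine Finset.sum_congr rfl fun j _ => ?_
  rw [← Complex.mul_conj]; ring

theorem sum_normSq_row {Q : Matrix n n ℂ} (h : Q * Qᴴ = 1) (p : n) :
    ∑ j, Complex.normSq (Q p j) = 1 := by
  have := congrFun (congrFun h p) p
  have h2 := mul_diagonal_mul_conjTranspose_apply Q (fun _ => 1) p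
  simp only [Complex.ofReal_one, diagonal_one, mul_one, this, one_apply_eq] at h2
  exact_mod_cast h2.symm

theorem sum_normSq_col {Q : Matrix n n ℂ} (h : Qᴴ * Q = 1) (p : n) :
    ∑ j, Complex.normSq (Q j p) = 1 := by
  have := sum_normSq_row (Q := Qᴴ) (by simpa using h) p
  simpa [conjTranspose_apply] using this

end

/-- In a product of eigenbases of the partial traces, the line sums of the diagonal of `X` are the
eigenvalues of the partial traces. -/
theorem exists_unitary_charpoly_ptraceSum {m n : Type*} [Fintype m] [Fintype n] [DecidableEq m]
    [DecidableEq n] {X : Matrix (m × n) (m × n) ℂ} (hX : X.IsHermitian) :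
    ∃ V : Matrix (m × n) (m × n) ℂ, V * Vᴴ = 1 ∧
      (ptraceSum X).charpoly = ∏ e, (Polynomial.X -
        Polynomial.C ((lineSums (fun p => ((V * X * Vᴴ) p p).re) e : ℝ) : ℂ)) := by
  classical
  have h1 : (ptrace₁ X).IsHermitian := by
    ext s t; simp [ptrace₁, hX.apply]
  have h2 : (ptrace₂ X).IsHermitian := by
    ext s t; simp [ptrace₂, hX.apply]
  set A := (h1.eigenvectorUnitary : Matrix n n ℂ) with hA
  set B := (h2.eigenvectorUnitary : Matrix m m ℂ) with hB
  have A1 : Aᴴ * A = 1 := (Unitary.mem_iff.1 h1.eigenvectorUnitary.2).1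
  have B1 : Bᴴ * B = 1 := (Unitary.mem_iff.1 h2.eigenvectorUnitary.2).1
  have A2 : A * Aᴴ = 1 := (Unitary.mem_iff.1 h1.eigenvectorUnitary.2).2
  have B2 : B * Bᴴ = 1 := (Unitary.mem_iff.1 h2.eigenvectorUnitary.2).2
  let K : Matrix (m × n) (m × n) ℂ := kroneckerMap (· * ·) B A
  have hK : Kᴴ = kroneckerMap (· * ·) Bᴴ Aᴴ := conjTranspose_kronecker _ _
  refine ⟨Kᴴ, ?_, ?_⟩
  · rw [conjTranspose_conjTranspose, hK, ← mul_kronecker_mul, A1, B1, one_kronecker_one]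
  have e1 (s : n) : ∑ i, (Kᴴ * X * K) (i, s) (i, s) = h1.eigenvalues s := by
    have a : ∑ i, (Kᴴ * X * K) (i, s) (i, s) = (ptrace₁ (Kᴴ * X * K) * Matrix.single s s 1).trace := by
      rw [trace_mul_single_self]; rfl
    rw [a, ← trace_mul_one_kronecker, Matrix.mul_assoc, Matrix.mul_assoc, Matrix.trace_mul_comm,
      Matrix.mul_assoc, hK, Matrix.mul_assoc, ← mul_kronecker_mul, ← mul_kronecker_mul,
      Matrix.one_mul, B2, trace_mul_one_kronecker, ← Matrix.mul_assoc, ← Matrix.mul_assoc,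
      Matrix.trace_mul_comm, ← Matrix.mul_assoc, ← Matrix.mul_assoc, hA,
      star_eigenvectorUnitary_mul_mul, trace_mul_single_self]
    simp
  have e2 (i : m) : ∑ s, (Kᴴ * X * K) (i, s) (i, s) = h2.eigenvalues i := by
    have a : ∑ s, (Kᴴ * X * K) (i, s) (i, s) = (ptrace₂ (Kᴴ * X * K) * Matrix.single i i 1).trace := by
      rw [trace_mul_single_self]; rfl
    rw [a, ← trace_mul_kronecker_one, Matrix.mul_assoc, Matrix.mul_assoc, Matrix.trace_mul_comm,
      Matrix.mul_assoc, hK, Matrix.mul_assoc, ← mul_kronecker_mul, ← mul_kronecker_mul,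
      Matrix.one_mul, A2, trace_mul_kronecker_one, ← Matrix.mul_assoc, ← Matrix.mul_assoc,
      Matrix.trace_mul_comm, ← Matrix.mul_assoc, ← Matrix.mul_assoc, hB,
      star_eigenvectorUnitary_mul_mul, trace_mul_single_self]
    simp
  rw [conjTranspose_conjTranspose, ptraceSum, charpoly_fromBlocks_zero₁₂, h1.charpoly_eq,
    h2.charpoly_eq, Fintype.prod_sum_type]
  have f1 (s : n) : lineSums (fun p => ((Kᴴ * X * K) p p).re) (Sum.inl s) = h1.eigenvalues s := by
    have := congrArg Complex.re (e1 s)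
    rwa [Complex.re_sum] at this
  have f2 (s : m) : lineSums (fun p => ((Kᴴ * X * K) p p).re) (Sum.inr s) = h2.eigenvalues s := by
    have := congrArg Complex.re (e2 s)
    rwa [Complex.re_sum] at this
  simp only [f1, f2]
  rfl

/-- An off-diagonal entry of a partial trace involves only pairs of cells in a common row or a
common column, so other off-diagonal entries of `X` are harmless. -/
theorem charpoly_ptraceSum_of_offdiag {m n : Type*} [Fintype m] [Fintype n] [DecidableEq m]
    [DecidableEq n] {X : Matrix (m × n) (m × n) ℂ} {x : m × n → ℝ} (hd : ∀ p, X p p = x p)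
    (h : ∀ p q, p ≠ q → p.1 = q.1 ∨ p.2 = q.2 → X p q = 0) :
    (ptraceSum X).charpoly = ∏ e, (Polynomial.X - Polynomial.C ((lineSums x e : ℝ) : ℂ)) := by
  have : ptraceSum X = diagonal fun e => ((lineSums x e : ℝ) : ℂ) := by
    ext e f
    rcases e with s | i <;> rcases f with t | j
    · by_cases hst : s = t
      · subst hst
        simp [ptraceSum, ptrace₁, lineSums, hd]
      · rw [diagonal_apply_ne _ (by simpa using hst)]
        simp only [ptraceSum, fromBlocks_apply₁₁, ptrace₁, of_apply]
        exact Finset.sum_eq_zero fun i _ => h _ _ (by simpa using hst) (Or.inl rfl)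
    · simp [ptraceSum]
    · simp [ptraceSum]
    · by_cases hst : i = j
      · subst hst
        simp [ptraceSum, ptrace₂, lineSums, hd]
      · rw [diagonal_apply_ne _ (by simpa using hst)]
        simp only [ptraceSum, fromBlocks_apply₂₂, ptrace₂, of_apply]
        exact Finset.sum_eq_zero fun i _ => h _ _ (by simpa using hst) (Or.inr rfl)
  rw [this, charpoly_diagonal]

/-- The eigenvalues of `C` in nonincreasing order, as a sequence indexed from `0`. -/
noncomputable def eigSeq {n : Type*} [Fintype n] [DecidableEq n] (C : Matrix n n ℂ)
    (hC : C.IsHermitian) (k : ℕ) : ℝ :=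
  eig C hC (k + 1)

/-! ### The ordered spectrum, Schur's inequality and reflections. -/

section

variable {n : Type*} [Fintype n] [DecidableEq n] {C : Matrix n n ℂ}

theorem eigSeq_of_lt (hC : C.IsHermitian) {k : ℕ} (hk : k < Fintype.card n) :
    eigSeq C hC k = hC.eigenvalues₀ ⟨k, hk⟩ := by
  rw [eigSeq, eig, dif_pos (by omega)]; rfl

theorem eigSeq_of_le (hC : C.IsHermitian) {k : ℕ} (hk : Fintype.card n ≤ k) :
    eigSeq C hC k = 0 := by
  rw [eigSeq, eig, dif_neg (by omega)]

theorem eigenvalues₀_nonneg (hC : C.PosSemidef) (k : Fin (Fintype.card n)) :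
    0 ≤ hC.isHermitian.eigenvalues₀ k := by
  have := hC.eigenvalues_nonneg ((Fintype.equivOfCardEq (Fintype.card_fin _)) k)
  simpa [IsHermitian.eigenvalues] using this

theorem eigSeq_nonneg (hC : C.PosSemidef) (k : ℕ) : 0 ≤ eigSeq C hC.isHermitian k := by
  rcases lt_or_ge k (Fintype.card n) with h | h
  · rw [eigSeq_of_lt _ h]; exact eigenvalues₀_nonneg hC _
  · rw [eigSeq_of_le _ h]

/-- Positivity matters here: the default value `0` beyond the size of the matrix must not exceed the
smallest eigenvalue. -/
theorem eigSeq_antitone (hC : C.PosSemidef) : Antitone (eigSeq C hC.isHermitian) := by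
  intro a b hab
  rcases lt_or_ge b (Fintype.card n) with h | h
  · rw [eigSeq_of_lt _ h, eigSeq_of_lt _ (hab.trans_lt h)]
    exact hC.isHermitian.eigenvalues₀_antitone (by simpa using hab)
  · rw [eigSeq_of_le _ h]; exact eigSeq_nonneg hC a

/-- The positive terms of a nonincreasing sequence form an initial segment, and the rank counts
them. -/
theorem eigSeq_pos_iff (hC : C.PosSemidef) (k : ℕ) :
    0 < eigSeq C hC.isHermitian k ↔ k < C.rank := by
  set f := eigSeq C hC.isHermitian with hf
  have hanti : Antitone f := eigSeq_antitone hC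
  have hnn : ∀ k, 0 ≤ f k := eigSeq_nonneg hC
  set A := (Finset.range (Fintype.card n)).filter fun k => 0 < f k with hA
  have hr : C.rank = A.card := by
    rw [hC.isHermitian.rank_eq_card_non_zero_eigs, Fintype.card_subtype]
    let e : n ≃ Fin (Fintype.card n) := (Fintype.equivOfCardEq (Fintype.card_fin _)).symm
    refine Finset.card_nbij (fun i => (e i).val) ?_ ?_ ?_
    · intro i hi
      have hi : hC.isHermitian.eigenvalues i ≠ 0 := by simpa using hi
      have h2 : f (e i) = hC.isHermitian.eigenvalues i := eigSeq_of_lt _ (e i).2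
      simp only [hA, Finset.coe_filter, Finset.mem_range, Set.mem_ofPred_eq]
      exact ⟨(e i).2, lt_of_le_of_ne (hnn _) (by rw [h2]; exact hi.symm)⟩
    · intro i _ j _ h
      exact e.injective (Fin.ext h)
    · intro k hk
      simp only [hA, Finset.coe_filter, Finset.mem_range, Set.mem_ofPred_eq] at hk
      refine ⟨e.symm ⟨k, hk.1⟩, ?_, by simp⟩
      have h2 : f k = hC.isHermitian.eigenvalues (e.symm ⟨k, hk.1⟩) := by
        refine (eigSeq_of_lt _ hk.1).trans ?_; simp [IsHermitian.eigenvalues, e]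
      simp only [Finset.coe_filter, Finset.mem_univ, true_and, Set.mem_ofPred_eq]
      rw [← h2]; exact hk.2.ne'
  have hlt : ∀ k, 0 < f k → k < Fintype.card n := fun k hk => by
    by_contra h
    rw [hf, eigSeq_of_le _ (not_lt.1 h)] at hk
    exact lt_irrefl _ hk
  rw [hr]
  constructor
  · intro hk
    have : Finset.range (k + 1) ⊆ A := fun i hi => by
      have hik : i ≤ k := by simpa [Nat.lt_succ_iff] using hi
      have := hk.trans_le (hanti hik)
      simp only [hA, Finset.mem_filter, Finset.mem_range]
      exact ⟨hlt i this, this⟩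
    have := Finset.card_le_card this
    rw [Finset.card_range] at this
    omega
  · intro hk
    by_contra h
    have : A ⊆ Finset.range k := fun i hi => by
      simp only [hA, Finset.mem_filter, Finset.mem_range] at hi ⊢
      by_contra hik
      exact h (hi.2.trans_le (hanti (not_lt.1 hik)))
    have := Finset.card_le_card this
    rw [Finset.card_range] at this
    omega

/-- The freedom in `σ` allows any arrangement of the eigenvalues in the cells as a starting
diagonal. -/
theorem exists_unitary_eq_mul_diagonal_mul {N : ℕ} (hC : C.IsHermitian) (σ : n ≃ Fin N) :
    ∃ Z : Matrix n n ℂ, Zᴴ * Z = 1 ∧ Z * Zᴴ = 1 ∧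
      C = Z * (diagonal fun p => (eigSeq C hC (σ p) : ℂ)) * Zᴴ := by
  have hN : N = Fintype.card n := by simpa using (Fintype.card_congr σ).symm
  subst hN
  let e : n ≃ Fin (Fintype.card n) := (Fintype.equivOfCardEq (Fintype.card_fin _)).symm
  let g : n ≃ n := σ.trans e.symm
  set W := (hC.eigenvectorUnitary : Matrix n n ℂ) with hW
  have W1 : Wᴴ * W = 1 := (Unitary.mem_iff.1 hC.eigenvectorUnitary.2).1
  have W2 : W * Wᴴ = 1 := (Unitary.mem_iff.1 hC.eigenvectorUnitary.2).2
  refine ⟨W.submatrix id g, ?_, ?_, ?_⟩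
  · rw [conjTranspose_submatrix]
    rw [show (W.submatrix id g) = W.submatrix (Equiv.refl n) g from rfl,
      show (Wᴴ.submatrix g id) = Wᴴ.submatrix g (Equiv.refl n) from rfl,
      submatrix_mul_equiv, W1, submatrix_one_equiv]
  · rw [conjTranspose_submatrix, submatrix_mul_equiv, W2, submatrix_id_id]
  · have : (diagonal fun p => (eigSeq C hC (σ p) : ℂ)) =
        (diagonal fun p => (hC.eigenvalues p : ℂ)).submatrix g g := by
      rw [submatrix_diagonal_equiv]
      congr 1
      ext p
      simp only [Function.comp_apply, g]
      rw [eigSeq_of_lt _ (σ p).2]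
      simp [IsHermitian.eigenvalues, e]
    rw [this, conjTranspose_submatrix, submatrix_mul_equiv, submatrix_mul_equiv, submatrix_id_id]
    exact eq_eigenvectorUnitary_mul_mul hC

/-- **Schur**: the diagonal of a unitary conjugate is majorized by the spectrum. -/
theorem sum_diag_conj_le {N : ℕ} (hN : Fintype.card n = N) (hC : C.PosSemidef) {V : Matrix n n ℂ}
    (hV : V * Vᴴ = 1) (S : Finset n) :
    ∑ p ∈ S, ((V * C * Vᴴ) p p).re ≤
      ∑ i ∈ Finset.range S.card, eigSeq C hC.isHermitian i := by
  let σ : n ≃ Fin N := Fintype.equivFinOfCardEq hN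
  obtain ⟨Z, Z1, Z2, hZ⟩ := exists_unitary_eq_mul_diagonal_mul hC.isHermitian σ
  set f := eigSeq C hC.isHermitian with hf
  have hQ : (V * Z) * (V * Z)ᴴ = 1 := by
    rw [conjTranspose_mul, Matrix.mul_assoc, ← Matrix.mul_assoc Z, Z2, Matrix.one_mul, hV]
  have hQ' : (V * Z)ᴴ * (V * Z) = 1 := mul_eq_one_comm.1 hQ
  have hd : ∀ p, ((V * C * Vᴴ) p p).re = ∑ j, Complex.normSq ((V * Z) p j) * f (σ j) := by
    intro p
    have : V * C * Vᴴ = (V * Z) * (diagonal fun p => (f (σ p) : ℂ)) * (V * Z)ᴴ := by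
      conv_lhs => rw [hZ]
      simp only [conjTranspose_mul, Matrix.mul_assoc]
    rw [this, mul_diagonal_mul_conjTranspose_apply, Complex.ofReal_re]
  simp only [hd]
  rw [Finset.sum_comm]
  simp only [← Finset.sum_mul]
  rw [← σ.symm.sum_comp]
  simp only [Equiv.apply_symm_apply]
  -- The squared moduli of a unitary matrix are doubly stochastic; the weights are its column sums
  -- over the rows in `S`, of total mass `S.card`.
  refine sum_weight_mul_le (eigSeq_antitone hC) (hN ▸ S.card_le_univ) _ (fun i => ?_) (fun i => ?_) ?_
  · exact Finset.sum_nonneg fun _ _ => Complex.normSq_nonneg _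
  · rw [← sum_normSq_col hQ' (σ.symm i)]
    exact Finset.sum_le_sum_of_subset_of_nonneg (Finset.subset_univ _)
      fun _ _ _ => Complex.normSq_nonneg _
  · rw [σ.symm.sum_comp fun i => ∑ p ∈ S, Complex.normSq ((V * Z) p i), Finset.sum_comm]
    simp [sum_normSq_row hQ]

theorem sum_diag_conj_eq {N : ℕ} (hN : Fintype.card n = N) (hC : C.IsHermitian) {V : Matrix n n ℂ}
    (hV : V * Vᴴ = 1) :
    ∑ p, ((V * C * Vᴴ) p p).re = ∑ i ∈ Finset.range N, eigSeq C hC i := by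
  have h1 : ∑ p, ((V * C * Vᴴ) p p).re = C.trace.re := by
    rw [← Complex.re_sum]
    change ((V * C * Vᴴ).trace).re = _
    rw [Matrix.trace_mul_comm, ← Matrix.mul_assoc, mul_eq_one_comm.1 hV, Matrix.one_mul]
  rw [h1, hC.trace_eq_sum_eigenvalues, Complex.re_sum]
  subst hN
  rw [← Fin.sum_univ_eq_sum_range]
  simp only [IsHermitian.eigenvalues, eigSeq_of_lt hC (Fin.is_lt _)]
  exact Equiv.sum_comp (Fintype.equivOfCardEq (Fintype.card_fin _)).symm _

/-- Conjugating a real diagonal matrix by a reflection in a coordinate plane moves an arbitrary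
part `δ` of the difference of two diagonal entries, and creates no off-diagonal entries outside
this plane. -/
theorem exists_reflection (f : n → ℝ) {p q : n} (hpq : p ≠ q) {δ : ℝ} (h0 : 0 ≤ δ)
    (h1 : δ ≤ f p - f q) :
    ∃ R : Matrix n n ℂ, R * Rᴴ = 1 ∧
      (∀ i, (R * (diagonal fun i => (f i : ℂ)) * Rᴴ) i i =
        ((f i - (if i = p then δ else 0) + (if i = q then δ else 0) : ℝ) : ℂ)) ∧
      ∀ i j, i ≠ j → ¬(i = p ∧ j = q) → ¬(i = q ∧ j = p) →
        (R * (diagonal fun i => (f i : ℂ)) * Rᴴ) i j = 0 := by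
  -- The reflection in the unit vector `a e_p + b e_q` moves the fraction `4a²b²` of `f p - f q`.
  -- With `a² = (1 - r)/2` and `b² = (1 + r)/2` this fraction is `1 - r²`, hence the choice `r = √(1
  -- - τ)`.
  obtain ⟨a, b, hab, hδ⟩ : ∃ a b : ℝ, a ^ 2 + b ^ 2 = 1 ∧
      4 * a ^ 2 * b ^ 2 * (f p - f q) = δ := by
    rcases eq_or_lt_of_le (h0.trans h1) with h | h
    · exact ⟨1, 0, by norm_num, by rw [← h] at h1; linarith⟩
    · set τ := δ / (f p - f q) with hτ
      have ht1 : τ ≤ 1 := (div_le_one h).2 h1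
      have ht0 : 0 ≤ τ := div_nonneg h0 h.le
      set r := Real.sqrt (1 - τ) with hr
      have r0 : 0 ≤ r := Real.sqrt_nonneg _
      have r2 : r ^ 2 = 1 - τ := Real.sq_sqrt (by linarith)
      have r1 : r ≤ 1 := by nlinarith
      refine ⟨Real.sqrt ((1 - r) / 2), Real.sqrt ((1 + r) / 2), ?_, ?_⟩
      · rw [Real.sq_sqrt (by linarith), Real.sq_sqrt (by linarith)]; ring
      · rw [Real.sq_sqrt (by linarith), Real.sq_sqrt (by linarith)]
        have : 4 * ((1 - r) / 2) * ((1 + r) / 2) = τ := by nlinarith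
        rw [this, hτ, div_mul_cancel₀ _ h.ne']
  let v : n → ℂ := fun i => if i = p then (a : ℂ) else if i = q then (b : ℂ) else 0
  have vp : v p = a := by simp [v]
  have vq : v q = b := by simp [v, hpq.symm]
  have v0 : ∀ i, i ≠ p → i ≠ q → v i = 0 := fun i h1 h2 => by simp [v, h1, h2]
  have vs : star v = v := by
    ext i; simp only [v, Pi.star_apply]; split_ifs <;> simp
  have hsum : ∀ g : n → ℂ, (∀ i, i ≠ p → i ≠ q → g i = 0) → ∑ i, g i = g p + g q := fun g hg => by
    rw [← Finset.sum_pair hpq]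
    exact (Finset.sum_subset (Finset.subset_univ _) fun i _ hi => by
      simp only [Finset.mem_insert, Finset.mem_singleton, not_or] at hi
      exact hg i hi.1 hi.2).symm
  let R : Matrix n n ℂ := 1 - (2 : ℂ) • vecMulVec v v
  have hRs : Rᴴ = R := by
    simp only [R, conjTranspose_sub, conjTranspose_one, conjTranspose_smul,
      conjTranspose_vecMulVec, vs]
    simp
  have hab' : (a : ℂ) ^ 2 + (b : ℂ) ^ 2 = 1 := by exact_mod_cast hab
  have hvv : v ⬝ᵥ v = 1 := by
    rw [dotProduct, hsum _ fun i h1 h2 => by rw [v0 i h1 h2]; simp, vp, vq, ← hab']; ring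
  have hent : ∀ i j, (R * (diagonal fun i => (f i : ℂ)) * Rᴴ) i j =
      (if i = j then (f i : ℂ) else 0) +
        v i * v j * (4 * (a ^ 2 * f p + b ^ 2 * f q) - 2 * f i - 2 * f j) := by
    intro i j
    have hκ : ∑ k, v k * f k * v k = a ^ 2 * f p + b ^ 2 * f q := by
      rw [hsum _ fun i h1 h2 => by rw [v0 i h1 h2]; simp, vp, vq]; ring
    have : (R * (diagonal fun i => (f i : ℂ)) * Rᴴ) i j =
        ∑ k, (((1 : Matrix n n ℂ) i k * (if k = j then (f k : ℂ) else 0) - 2 * ((1 : Matrix n n ℂ) i k * (f k * v k * v j))) -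
          2 * (v i * v k * (if k = j then (f k : ℂ) else 0)) + 4 * (v i * v j) * (v k * f k * v k)) := by
      rw [hRs, mul_apply]
      refine Finset.sum_congr rfl fun k _ => ?_
      rw [mul_diagonal]
      simp only [R, Matrix.sub_apply, Matrix.smul_apply, vecMulVec_apply, smul_eq_mul, one_apply]
      split_ifs <;> ring
    rw [this, Finset.sum_add_distrib, Finset.sum_sub_distrib, Finset.sum_sub_distrib,
      ← Finset.mul_sum, ← Finset.mul_sum, ← Finset.mul_sum, hκ]
    simp only [one_apply, ite_mul, one_mul, zero_mul, Finset.sum_ite_eq, Finset.mem_univ, if_true,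
      mul_ite, mul_zero, Finset.sum_ite_eq']
    split_ifs with h
    · subst h; ring
    · ring
  refine ⟨R, ?_, fun i => ?_, fun i j hij h1 h2 => ?_⟩
  · rw [hRs]
    simp only [R, Matrix.sub_mul, Matrix.mul_sub, Matrix.one_mul, Matrix.mul_one,
      Matrix.smul_mul, Matrix.mul_smul, vecMulVec_mul_vecMulVec, hvv, one_smul]
    module
  · rw [hent, if_pos rfl]
    have hδ' : (4 : ℂ) * a ^ 2 * b ^ 2 * (f p - f q) = δ := by exact_mod_cast hδ
    have hb : (b : ℂ) ^ 2 = 1 - a ^ 2 := by rw [← hab']; ring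
    have ha : (a : ℂ) ^ 2 = 1 - b ^ 2 := by rw [← hab']; ring
    by_cases hip : i = p
    · subst hip
      simp only [if_true, if_neg hpq, vp]
      push_cast
      rw [← hδ', hb]
      ring
    · by_cases hiq : i = q
      · subst hiq
        simp only [if_true, if_neg hip, vq]
        push_cast
        rw [← hδ', ha]
        ring
      · simp [hip, hiq, v0 i hip hiq]
  · rw [hent, if_neg hij]
    have : v i * v j = 0 := by
      by_cases hip : i = p
      · rw [v0 j (fun h => hij (hip.trans h.symm)) fun h => h1 ⟨hip, h⟩, mul_zero]
      · by_cases hiq : i = q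
        · rw [v0 j (fun h => h2 ⟨hiq, h⟩) fun h => hij (hiq.trans h.symm), mul_zero]
        · rw [v0 i hip hiq, zero_mul]
    rw [this]; ring

end

/-! ### Reduction to arrays. -/

/-- The line sums of `x` are weakly majorized by those of `z`. -/
def Dominated {m n : Type*} [Fintype m] [Fintype n] (x z : m × n → ℝ) : Prop :=
  ∀ S : Finset (n ⊕ m), ∃ S' : Finset (n ⊕ m), S'.card = S.card ∧
    ∑ e ∈ S, lineSums x e ≤ ∑ e ∈ S', lineSums z e

/-- The sum of the first `k` terms of a sequence. -/
def prefixSum (f : ℕ → ℝ) (k : ℕ) : ℝ := ∑ i ∈ Finset.range k, f i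

/-- The array of the terms of `f` arranged by the permutation `π`, rows first. -/
def arrangement (f : ℕ → ℝ) {d : ℕ} (π : Equiv.Perm (Fin (2 * d))) : Fin 2 × Fin d → ℝ :=
  fun p => f (π (finProdFinEquiv p))

/-- Moving the amount `δ` from the entry `(0, s)` to the entry `(1, t)`. -/
def transfer {d : ℕ} (x : Fin 2 × Fin d → ℝ) (s t : Fin d) (δ : ℝ) : Fin 2 × Fin d → ℝ :=
  fun p => x p - (if p = (0, s) then δ else 0) + (if p = (1, t) then δ else 0)

theorem sum_transfer {d : ℕ} (x : Fin 2 × Fin d → ℝ) (s t : Fin d) (δ : ℝ) :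
    ∑ p, transfer x s t δ p = ∑ p, x p := by
  simp [transfer, Finset.sum_add_distrib, Finset.sum_sub_distrib]

theorem specPtraceSum_majorizes_iff {m n : Type*} [Fintype m] [Fintype n] [DecidableEq m]
    [DecidableEq n] {X Y : Matrix (m × n) (m × n) ℂ} (hX : X.IsHermitian) (hY : Y.IsHermitian)
    {x y : m × n → ℝ}
    (hx : (ptraceSum X).charpoly =
      ∏ e, (Polynomial.X - Polynomial.C ((lineSums x e : ℝ) : ℂ)))
    (hy : (ptraceSum Y).charpoly =
      ∏ e, (Polynomial.X - Polynomial.C ((lineSums y e : ℝ) : ℂ)))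
    (hxy : ∑ p, x p = ∑ p, y p) :
    specPtraceSum X hX ≼ₘ specPtraceSum Y hY ↔ Dominated x y := by
  refine (majorizes_iff (ptraceSum_isHermitian hX).eigenvalues₀_antitone
    (ptraceSum_isHermitian hY).eigenvalues₀_antitone
    (exists_equiv_eigenvalues₀ (ptraceSum_isHermitian hX) hx)
    (exists_equiv_eigenvalues₀ (ptraceSum_isHermitian hY) hy)).trans ?_
  refine and_iff_left ?_
  rw [sum_lineSums, sum_lineSums, hxy]

section

variable {d : ℕ} {C : Matrix (Fin 2 × Fin d) (Fin 2 × Fin d) ℂ}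

theorem charpoly_ptraceSum_diagEig (hC : C.IsHermitian) (π : Equiv.Perm (Fin (2 * d))) :
    (ptraceSum (diagEig C hC π)).charpoly = ∏ e, (Polynomial.X - Polynomial.C
      ((lineSums (fun p => eigSeq C hC (π (finProdFinEquiv p))) e : ℝ) : ℂ)) := by
  refine charpoly_ptraceSum_of_offdiag (fun p => ?_) fun p q hpq _ => ?_
  · simp [diagEig, eigSeq]
  · simp [diagEig, hpq]

theorem sum_eigSeq_comp (hC : C.IsHermitian) (σ : Fin 2 × Fin d ≃ Fin (2 * d)) :
    ∑ p, eigSeq C hC (σ p) = ∑ i ∈ Finset.range (2 * d), eigSeq C hC i := by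
  rw [← Fin.sum_univ_eq_sum_range, ← σ.sum_comp]

/-- The line sums that occur for unitary conjugates are those of arrays majorized by the
spectrum. -/
theorem exists_array_of_conj (hC : C.PosSemidef) (U : Matrix.unitaryGroup (Fin 2 × Fin d) ℂ) :
    ∃ y : Fin 2 × Fin d → ℝ,
      (∀ S : Finset (Fin 2 × Fin d),
        ∑ p ∈ S, y p ≤ prefixSum (eigSeq C hC.isHermitian) S.card) ∧
      ∑ p, y p = prefixSum (eigSeq C hC.isHermitian) (2 * d) ∧
      ∀ π : Equiv.Perm (Fin (2 * d)),
        specPtraceSum (U.val * C * U.valᴴ)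
            (Matrix.isHermitian_mul_mul_conjTranspose U.val hC.isHermitian) ≼ₘ
          specPtraceSum (diagEig C hC.isHermitian π) (diagEig_isHermitian hC.isHermitian π) ↔
        Dominated y (arrangement (eigSeq C hC.isHermitian) π) := by
  obtain ⟨V, hV, hVc⟩ := exists_unitary_charpoly_ptraceSum
    (Matrix.isHermitian_mul_mul_conjTranspose U.val hC.isHermitian)
  have hW : (V * U.val) * (V * U.val)ᴴ = 1 := by
    have hU : U.val * U.valᴴ = 1 := (Unitary.mem_iff.1 U.2).2
    rw [conjTranspose_mul, Matrix.mul_assoc, ← Matrix.mul_assoc U.val, hU, Matrix.one_mul, hV]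
  have hE : V * (U.val * C * U.valᴴ) * Vᴴ = (V * U.val) * C * (V * U.val)ᴴ := by
    simp only [conjTranspose_mul, Matrix.mul_assoc]
  rw [hE] at hVc
  have hcard : Fintype.card (Fin 2 × Fin d) = 2 * d := by simp
  refine ⟨_, sum_diag_conj_le hcard hC hW, sum_diag_conj_eq hcard hC.isHermitian hW, fun π => ?_⟩
  refine specPtraceSum_majorizes_iff _ _ hVc (charpoly_ptraceSum_diagEig _ π) ?_
  rw [sum_diag_conj_eq hcard hC.isHermitian hW]
  exact (sum_eigSeq_comp hC.isHermitian (finProdFinEquiv.trans π)).symm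

/-- Since `s ≠ t`, the cells `(0, s)` and `(1, t)` share no line, so the off-diagonal entries
created by the reflection do not reach the partial traces. -/
theorem exists_conj_of_transfer (hC : C.PosSemidef) (σ : Equiv.Perm (Fin (2 * d)))
    {s t : Fin d} (hst : s ≠ t) {δ : ℝ} (h0 : 0 ≤ δ)
    (h1 : δ ≤ arrangement (eigSeq C hC.isHermitian) σ (0, s) -
      arrangement (eigSeq C hC.isHermitian) σ (1, t)) :
    ∃ U : Matrix.unitaryGroup (Fin 2 × Fin d) ℂ, ∀ π : Equiv.Perm (Fin (2 * d)),
      specPtraceSum (U.val * C * U.valᴴ)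
          (Matrix.isHermitian_mul_mul_conjTranspose U.val hC.isHermitian) ≼ₘ
        specPtraceSum (diagEig C hC.isHermitian π) (diagEig_isHermitian hC.isHermitian π) →
      Dominated (transfer (arrangement (eigSeq C hC.isHermitian) σ) s t δ)
        (arrangement (eigSeq C hC.isHermitian) π) := by
  obtain ⟨Z, Z1, Z2, hZ⟩ := exists_unitary_eq_mul_diagonal_mul hC.isHermitian (finProdFinEquiv.trans σ)
  obtain ⟨R, hR, hd, ho⟩ := exists_reflection (arrangement (eigSeq C hC.isHermitian) σ)
    (p := (0, s)) (q := (1, t)) (by simp) h0 h1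
  have hU : (R * Zᴴ) * (R * Zᴴ)ᴴ = 1 := by
    rw [conjTranspose_mul, conjTranspose_conjTranspose, Matrix.mul_assoc, ← Matrix.mul_assoc Zᴴ,
      Z1, Matrix.one_mul, hR]
  refine ⟨⟨R * Zᴴ, Unitary.mem_iff.2 ⟨mul_eq_one_comm.1 hU, hU⟩⟩, fun π => ?_⟩
  have hE : (R * Zᴴ) * C * (R * Zᴴ)ᴴ =
      R * (diagonal fun p => (arrangement (eigSeq C hC.isHermitian) σ p : ℂ)) * Rᴴ := by
    set D := diagonal fun p => (arrangement (eigSeq C hC.isHermitian) σ p : ℂ) with hD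
    replace hZ : C = Z * D * Zᴴ := hZ
    calc (R * Zᴴ) * C * (R * Zᴴ)ᴴ = (R * Zᴴ) * (Z * D * Zᴴ) * (R * Zᴴ)ᴴ := by rw [← hZ]
      _ = R * (Zᴴ * Z) * D * (Zᴴ * Z) * Rᴴ := by
        simp only [conjTranspose_mul, conjTranspose_conjTranspose, Matrix.mul_assoc]
      _ = R * D * Rᴴ := by rw [Z1, Matrix.mul_one, Matrix.mul_one]
  refine (specPtraceSum_majorizes_iff _ _ (charpoly_ptraceSum_of_offdiag
    (fun p => by rw [hE, hd]; rfl) fun p q hpq hl => ?_) (charpoly_ptraceSum_diagEig _ π) ?_).1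
  · rw [hE]
    refine ho p q hpq ?_ ?_
    · rintro ⟨rfl, rfl⟩
      simp [hst] at hl
    · rintro ⟨rfl, rfl⟩
      simp [hst.symm] at hl
  · refine Eq.trans ?_ ((sum_eigSeq_comp hC.isHermitian (finProdFinEquiv.trans σ)).trans
      (sum_eigSeq_comp hC.isHermitian (finProdFinEquiv.trans π)).symm)
    exact sum_transfer (arrangement (eigSeq C hC.isHermitian) σ) s t δ

end

/-! ### Line sums of a majorized array against those of the sorted array. -/

theorem prefixSum_succ (f : ℕ → ℝ) (k : ℕ) : prefixSum f (k + 1) = prefixSum f k + f k :=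
  Finset.sum_range_succ _ _

theorem prefixSum_zero (f : ℕ → ℝ) : prefixSum f 0 = 0 := Finset.sum_range_zero _

theorem prefixSum_mono {f : ℕ → ℝ} (hf : ∀ i, 0 ≤ f i) : Monotone (prefixSum f) :=
  monotone_nat_of_le_succ fun k => by rw [prefixSum_succ]; linarith [hf k]

theorem prefixSum_eq_of_const {f : ℕ → ℝ} {a c m : ℕ} {b : ℝ} (h : ∀ i, a ≤ i → i < c → f i = b)
    (ham : a ≤ m) (hmc : m ≤ c) : prefixSum f m = prefixSum f a + ((m : ℝ) - a) * b := by
  induction m, ham using Nat.le_induction with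
  | base => ring
  | succ m hm ih =>
    rw [prefixSum_succ, ih (by omega), h m hm (by omega)]
    push_cast; ring

section

variable {d : ℕ} {f : ℕ → ℝ} {y z : Fin 2 × Fin d → ℝ}

theorem sum_lineSums_disjSum (y : Fin 2 × Fin d → ℝ) (K : Finset (Fin d)) (J : Finset (Fin 2)) :
    ∑ e ∈ K.disjSum J, lineSums y e = (∑ s ∈ K, (y (0, s) + y (1, s))) +
      ∑ i ∈ J, ∑ s, y (i, s) := by
  rw [Finset.sum_disjSum]
  simp [lineSums, Fin.sum_univ_two]

theorem dominated_of_forall_disjSum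
    (h : ∀ (K : Finset (Fin d)) (J : Finset (Fin 2)), ∃ (K' : Finset (Fin d)) (J' : Finset (Fin 2)),
      K'.card + J'.card = K.card + J.card ∧
        ∑ e ∈ K.disjSum J, lineSums y e ≤ ∑ e ∈ K'.disjSum J', lineSums z e) :
    Dominated y z := by
  intro S
  obtain ⟨K', J', h1, h2⟩ := h S.toLeft S.toRight
  rw [Finset.toLeft_disjSum_toRight] at h2
  exact ⟨K'.disjSum J', by
    rw [Finset.card_disjSum, h1, Finset.card_toLeft_add_card_toRight], h2⟩

theorem sum_row_add_sum_row (y : Fin 2 × Fin d → ℝ) (i : Fin 2) :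
    ∑ s, y (i, s) + ∑ s, y (1 - i, s) = ∑ p, y p := by
  rw [Fintype.sum_prod_type, Fin.sum_univ_two]
  fin_cases i
  · simp
  · simp [add_comm]

theorem sum_cols_le (hy : ∀ S : Finset (Fin 2 × Fin d), ∑ p ∈ S, y p ≤ prefixSum f S.card)
    (K : Finset (Fin d)) :
    ∑ s ∈ K, (y (0, s) + y (1, s)) ≤ prefixSum f (2 * K.card) := by
  have := hy (Finset.univ ×ˢ K)
  rwa [Finset.sum_product_right, Finset.card_product, Finset.card_univ, Fintype.card_fin,
    Finset.sum_congr rfl fun s _ => Fin.sum_univ_two fun i => y (i, s)] at this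

/-- Inclusion–exclusion: the columns `K` and the row `i` cover `d + K.card` cells, of which `K.card`
are counted twice; majorization is applied to the union and to the intersection. -/
theorem sum_cols_add_row_le (hy : ∀ S : Finset (Fin 2 × Fin d), ∑ p ∈ S, y p ≤ prefixSum f S.card)
    (K : Finset (Fin d)) (i : Fin 2) :
    ∑ s ∈ K, (y (0, s) + y (1, s)) + ∑ s, y (i, s) ≤
      prefixSum f K.card + prefixSum f (d + K.card) := by
  set A : Finset (Fin 2 × Fin d) := Finset.univ ×ˢ K with hA
  set B : Finset (Fin 2 × Fin d) := {i} ×ˢ Finset.univ with hB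
  have hAs : ∑ p ∈ A, y p = ∑ s ∈ K, (y (0, s) + y (1, s)) := by
    rw [hA, Finset.sum_product_right, Finset.sum_congr rfl fun s _ => Fin.sum_univ_two _]
  have hBs : ∑ p ∈ B, y p = ∑ s, y (i, s) := by
    rw [hB, Finset.sum_product, Finset.sum_singleton]
  have hI : A ∩ B = {i} ×ˢ K := by
    ext ⟨j, s⟩; simp [hA, hB, and_comm]
  have hIc : (A ∩ B).card = K.card := by rw [hI]; simp
  have hUc : (A ∪ B).card = d + K.card := by
    have := Finset.card_union_add_card_inter A B
    have hAc : A.card = 2 * K.card := by rw [hA, Finset.card_product]; simp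
    have hBc : B.card = d := by rw [hB, Finset.card_product]; simp
    omega
  rw [← hAs, ← hBs, ← Finset.sum_union_inter]
  have h1 := hy (A ∪ B)
  have h2 := hy (A ∩ B)
  rw [hUc] at h1
  rw [hIc] at h2
  linarith

theorem card_filter_val_lt_of_le {k : ℕ} (hk : k ≤ d) :
    (Finset.univ.filter fun s : Fin d => s.val < k).card = k := by
  rw [Fin.card_filter_val_lt]; omega

theorem sum_filter_val_lt {k : ℕ} (hk : k ≤ d) (g : ℕ → ℝ) :
    ∑ s : Fin d with s.val < k, g s = ∑ i ∈ Finset.range k, g i := by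
  rw [Finset.sum_filter, Fin.sum_univ_eq_sum_range (fun i => if i < k then g i else 0),
    ← Finset.sum_filter]
  congr 1
  ext i
  simp only [Finset.mem_range, Finset.mem_filter]
  omega

theorem arrangement_one_zero (s : Fin d) :
    arrangement f (1 : Equiv.Perm (Fin (2 * d))) (0, s) = f s := by
  simp [arrangement]

theorem arrangement_one_one (s : Fin d) :
    arrangement f (1 : Equiv.Perm (Fin (2 * d))) (1, s) = f (d + s) := by
  simp [arrangement, add_comm]

theorem sum_range_shift (f : ℕ → ℝ) (d k : ℕ) :
    ∑ i ∈ Finset.range k, f (d + i) = prefixSum f (d + k) - prefixSum f d := by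
  rw [prefixSum, Finset.sum_range_add, prefixSum]; ring

theorem sum_cols_arrangement_one {k : ℕ} (hk : k ≤ d) :
    ∑ s : Fin d with s.val < k, (arrangement f (1 : Equiv.Perm (Fin (2 * d))) (0, s) +
      arrangement f (1 : Equiv.Perm (Fin (2 * d))) (1, s)) =
      prefixSum f k + prefixSum f (d + k) - prefixSum f d := by
  simp only [arrangement_one_zero, arrangement_one_one]
  rw [Finset.sum_add_distrib, sum_filter_val_lt hk f, sum_filter_val_lt hk fun i => f (d + i),
    sum_range_shift, ← prefixSum]
  ring

theorem sum_row_zero_arrangement_one :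
    ∑ s, arrangement f (1 : Equiv.Perm (Fin (2 * d))) (0, s) = prefixSum f d := by
  simp only [arrangement_one_zero]
  exact Fin.sum_univ_eq_sum_range f d

theorem sum_arrangement (π : Equiv.Perm (Fin (2 * d))) :
    ∑ p, arrangement f π p = prefixSum f (2 * d) := by
  rw [prefixSum, ← Fin.sum_univ_eq_sum_range, ← (finProdFinEquiv.trans π).sum_comp]
  rfl

theorem finset_fin_two_cases (J : Finset (Fin 2)) : J = ∅ ∨ (∃ i, J = {i}) ∨ J = Finset.univ := by
  revert J; decide

/-- This lets the top row replace one of `k + 1` columns. The index on the left is at most `d + k`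
unless `k = d - 1`, where the single surplus term is absorbed by `f 0`; there `k ≥ 1` because `d >
2`. -/
theorem prefixSum_two_mul_le (hf : Antitone f) (hf0 : ∀ i, 0 ≤ f i) (hd : 2 < d) {k : ℕ}
    (hk : k < d) :
    prefixSum f (2 * (k + 1)) ≤ prefixSum f k + prefixSum f (d + k) := by
  rcases (Nat.succ_le_of_lt hk).eq_or_lt with h | h
  · have : 2 * (k + 1) = (d + k) + 1 := by omega
    rw [this, prefixSum_succ]
    have h1 := prefixSum_mono hf0 (show 1 ≤ k by omega)
    rw [prefixSum_succ, prefixSum_zero] at h1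
    linarith [hf (Nat.zero_le (d + k))]
  · have h1 := prefixSum_mono hf0 (show 2 * (k + 1) ≤ d + k by omega)
    have h2 := prefixSum_mono hf0 (Nat.zero_le k)
    rw [prefixSum_zero] at h2
    linarith

/-- The criterion for the array in decreasing order to dominate: only the sets of lines that
contain both rows matter. -/
theorem dominated_arrangement_one (hf : Antitone f) (hf0 : ∀ i, 0 ≤ f i) (hd : 2 < d)
    (hy : ∀ S : Finset (Fin 2 × Fin d), ∑ p ∈ S, y p ≤ prefixSum f S.card)
    (hT : ∑ p, y p = prefixSum f (2 * d))
    (h : ∀ K : Finset (Fin d), 1 ≤ K.card → K.card < d →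
      ∑ s ∈ K, (y (0, s) + y (1, s)) ≤
        prefixSum f K.card + prefixSum f (d + K.card) - prefixSum f d ∨
      prefixSum f (2 * d) + ∑ s ∈ K, (y (0, s) + y (1, s)) ≤
        prefixSum f (K.card + 1) + prefixSum f (d + (K.card + 1))) :
    Dominated y (arrangement f (1 : Equiv.Perm (Fin (2 * d)))) := by
  have hone {k : ℕ} (hk : k ≤ d) : ∃ (K' : Finset (Fin d)) (J' : Finset (Fin 2)),
      K'.card + J'.card = k + 1 ∧
      prefixSum f k + prefixSum f (d + k) ≤ ∑ e ∈ K'.disjSum J',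
        lineSums (arrangement f (1 : Equiv.Perm (Fin (2 * d)))) e := by
    refine ⟨Finset.univ.filter fun s : Fin d => s.val < k, {0}, ?_, ?_⟩
    · rw [card_filter_val_lt_of_le hk, Finset.card_singleton]
    · rw [sum_lineSums_disjSum, sum_cols_arrangement_one hk, Finset.sum_singleton,
        sum_row_zero_arrangement_one]
      linarith
  refine dominated_of_forall_disjSum fun K J => ?_
  have hK : K.card ≤ d := by simpa using K.card_le_univ
  rcases finset_fin_two_cases J with rfl | ⟨i, rfl⟩ | rfl
  · rcases Nat.eq_zero_or_pos K.card with h0 | h0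
    · refine ⟨∅, ∅, by simp [h0], ?_⟩
      rw [Finset.card_eq_zero.1 h0]
      simp
    · obtain ⟨k, hk⟩ : ∃ k, K.card = k + 1 := ⟨K.card - 1, by omega⟩
      obtain ⟨K', J', h1, h2⟩ := hone (show k ≤ d by omega)
      refine ⟨K', J', by rw [h1, hk]; simp, le_trans ?_ h2⟩
      rw [sum_lineSums_disjSum, Finset.sum_empty, add_zero]
      refine (sum_cols_le hy K).trans ?_
      rw [hk]
      exact prefixSum_two_mul_le hf hf0 hd (by omega)
  · obtain ⟨K', J', h1, h2⟩ := hone hK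
    refine ⟨K', J', by rw [h1]; simp, le_trans ?_ h2⟩
    rw [sum_lineSums_disjSum, Finset.sum_singleton]
    exact sum_cols_add_row_le hy K i
  · have hrow : ∀ w : Fin 2 × Fin d → ℝ, ∑ i, ∑ s, w (i, s) = ∑ p, w p := fun w =>
      (Fintype.sum_prod_type _).symm
    have htwo : ∑ s ∈ K, (y (0, s) + y (1, s)) ≤
          prefixSum f K.card + prefixSum f (d + K.card) - prefixSum f d →
        ∃ (K' : Finset (Fin d)) (J' : Finset (Fin 2)),
      K'.card + J'.card = K.card + (Finset.univ : Finset (Fin 2)).card ∧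
        ∑ e ∈ K.disjSum Finset.univ, lineSums y e ≤ ∑ e ∈ K'.disjSum J',
          lineSums (arrangement f (1 : Equiv.Perm (Fin (2 * d)))) e := by
      intro h3
      refine ⟨Finset.univ.filter fun s : Fin d => s.val < K.card, Finset.univ, ?_, ?_⟩
      · rw [card_filter_val_lt_of_le hK]
      · rw [sum_lineSums_disjSum, sum_lineSums_disjSum, sum_cols_arrangement_one hK, hrow, hrow,
          hT, sum_arrangement]
        linarith
    rcases Nat.eq_zero_or_pos K.card with h0 | h0
    · apply htwo
      rw [h0, Finset.card_eq_zero.1 h0, prefixSum_zero]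
      simp
    · rcases hK.eq_or_lt with h1 | h1
      · apply htwo
        refine (sum_cols_le hy K).trans (le_of_eq ?_)
        rw [h1, two_mul]; ring
      · rcases h K h0 h1 with h2 | h2
        · exact htwo h2
        -- Under the second alternative, both rows and `K` are matched by the top row and one more
        -- column.
        · obtain ⟨K', J', h3, h4⟩ := hone (show K.card + 1 ≤ d by omega)
          refine ⟨K', J', by rw [h3]; simp, le_trans ?_ h4⟩
          rw [sum_lineSums_disjSum, hrow, hT]
          linarith

end

/-! ### Sufficiency of the four conditions. -/

section

variable {d : ℕ} {f : ℕ → ℝ} {y : Fin 2 × Fin d → ℝ}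

/-- `P` is constant from 3 on, so the total cancels against `P (d + k + 1)` and only `P (2k) ≤ P (k
+ 1)` remains: an equality for `k = 1`, and again for `k ≥ 2`, where both sides are the total. -/
theorem dominated_of_three_terms (hf : Antitone f) (hf0 : ∀ i, 0 ≤ f i) (hd : 2 < d)
    (hy : ∀ S : Finset (Fin 2 × Fin d), ∑ p ∈ S, y p ≤ prefixSum f S.card)
    (hT : ∑ p, y p = prefixSum f (2 * d)) (h : ∀ i, 3 ≤ i → f i = 0) :
    Dominated y (arrangement f (1 : Equiv.Perm (Fin (2 * d)))) := by
  refine dominated_arrangement_one hf hf0 hd hy hT fun K h1 h2 => Or.inr ?_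
  have hc : ∀ m, 3 ≤ m → prefixSum f m = prefixSum f 3 := fun m hm => by
    rw [prefixSum_eq_of_const (c := m) (fun i hi _ => h i hi) hm le_rfl]; ring
  have h3 := sum_cols_le hy K
  rw [hc (2 * d) (by omega), hc (d + (K.card + 1)) (by omega)]
  have h4 : prefixSum f (2 * K.card) ≤ prefixSum f (K.card + 1) := by
    rcases h1.eq_or_lt with h5 | h5
    · rw [← h5]
    · rw [hc _ (show 3 ≤ 2 * K.card by omega), hc _ (show 3 ≤ K.card + 1 by omega)]
  linarith

/-- On the plateau `P` is affine, and `2k + d = k + (d + k)`, so `P (2k) + P d = P k + P (d + k)`.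
-/
theorem sum_cols_le_of_const {a : ℕ} {b : ℝ} (hd : 2 < d)
    (hy : ∀ S : Finset (Fin 2 × Fin d), ∑ p ∈ S, y p ≤ prefixSum f S.card)
    (h : ∀ i, a ≤ i → i < 2 * d - 1 → f i = b) {K : Finset (Fin d)} (h1 : a ≤ K.card)
    (h2 : K.card < d) :
    ∑ s ∈ K, (y (0, s) + y (1, s)) ≤
      prefixSum f K.card + prefixSum f (d + K.card) - prefixSum f d := by
  refine (sum_cols_le hy K).trans (le_of_eq ?_)
  rcases Nat.eq_zero_or_pos K.card with h0 | h0
  · rw [h0, mul_zero, add_zero, prefixSum_zero]; ring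
  rw [prefixSum_eq_of_const (m := 2 * K.card) h (by omega) (by omega),
    prefixSum_eq_of_const (m := d + K.card) h (by omega) (by omega),
    prefixSum_eq_of_const (m := K.card) h (by omega) (by omega),
    prefixSum_eq_of_const (m := d) h (by omega) (by omega)]
  push_cast; ring

theorem dominated_of_const_from_one (hf : Antitone f) (hf0 : ∀ i, 0 ≤ f i) (hd : 2 < d)
    (hy : ∀ S : Finset (Fin 2 × Fin d), ∑ p ∈ S, y p ≤ prefixSum f S.card)
    (hT : ∑ p, y p = prefixSum f (2 * d)) {b : ℝ} (h : ∀ i, 1 ≤ i → i < 2 * d - 1 → f i = b) :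
    Dominated y (arrangement f (1 : Equiv.Perm (Fin (2 * d)))) :=
  dominated_arrangement_one hf hf0 hd hy hT fun _ h1 h2 =>
    Or.inl (sum_cols_le_of_const hd hy h h1 h2)

/-- A single column is the only selection not covered by the plateau; for it the required inequality
is `P 6 + P 2 ≤ P 2 + P 5`, that is, `f 5 = 0`. -/
theorem dominated_of_six (hf : Antitone f) (hf0 : ∀ i, 0 ≤ f i) (hd : d = 3)
    (hy : ∀ S : Finset (Fin 2 × Fin d), ∑ p ∈ S, y p ≤ prefixSum f S.card)
    (hT : ∑ p, y p = prefixSum f (2 * d)) {b : ℝ} (h : ∀ i, 2 ≤ i → i < 2 * d - 1 → f i = b)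
    (h5 : f 5 = 0) :
    Dominated y (arrangement f (1 : Equiv.Perm (Fin (2 * d)))) := by
  refine dominated_arrangement_one hf hf0 (by omega) hy hT fun K h1 h2 => ?_
  rcases h1.eq_or_lt with h3 | h3
  · right
    have h4 := sum_cols_le hy K
    rw [← h3] at h4 ⊢
    subst hd
    norm_num at h4 ⊢
    have : prefixSum f 6 = prefixSum f 5 + f 5 := prefixSum_succ f 5
    linarith
  · exact Or.inl (sum_cols_le_of_const (by omega) hy h h3 h2)

/-- The transposition of the second and the `(d + 1)`-st position. -/
def transposition (d : ℕ) (hd : 2 < d) : Equiv.Perm (Fin (2 * d)) :=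
  Equiv.swap ⟨1, by omega⟩ ⟨d, by omega⟩

theorem arrangement_transposition_zero (hd : 2 < d) (s : Fin d) :
    arrangement f (transposition d hd) (0, s) =
      f s + if s = (⟨1, by omega⟩ : Fin d) then f d - f 1 else 0 := by
  simp only [arrangement, transposition, Equiv.swap_apply_def, Fin.ext_iff,
    finProdFinEquiv_apply_val]
  have := s.2
  simp only [Fin.val_zero, mul_zero, add_zero]
  split_ifs with h1 h2
  · rw [h1]; ring
  · omega
  · simp

theorem arrangement_transposition_one (hd : 2 < d) (s : Fin d) :
    arrangement f (transposition d hd) (1, s) =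
      f (d + s) + if s = (⟨0, by omega⟩ : Fin d) then f 1 - f d else 0 := by
  simp only [arrangement, transposition, Equiv.swap_apply_def, Fin.ext_iff,
    finProdFinEquiv_apply_val]
  have := s.2
  have hv : f (finProdFinEquiv ((1 : Fin 2), s)) = f (d + s) := by simp [add_comm]
  simp only [Fin.val_one, mul_one]
  split_ifs with h1 h2 h3 h4 h5
  · omega
  · omega
  · simp [h4]
  · omega
  · omega
  · rw [hv, add_zero]

theorem sum_row_zero_arrangement_transposition (hd : 2 < d) :
    ∑ s, arrangement f (transposition d hd) (0, s) = prefixSum f d + (f d - f 1) := by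
  simp only [arrangement_transposition_zero]
  rw [Finset.sum_add_distrib, Finset.sum_ite_eq', if_pos (Finset.mem_univ _),
    Fin.sum_univ_eq_sum_range f d]
  rfl

theorem sum_cols_arrangement_transposition (hd : 2 < d) {k : ℕ} (h1 : 1 ≤ k) (hk : k ≤ d) :
    ∑ s : Fin d with s.val < k, (arrangement f (transposition d hd) (0, s) +
      arrangement f (transposition d hd) (1, s)) =
      prefixSum f k + prefixSum f (d + k) - prefixSum f d + if k = 1 then f 1 - f d else 0 := by
  simp only [arrangement_transposition_zero, arrangement_transposition_one]
  rw [Finset.sum_add_distrib, Finset.sum_add_distrib, Finset.sum_add_distrib,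
    sum_filter_val_lt hk f, sum_filter_val_lt hk fun i => f (d + i), sum_range_shift,
    Finset.sum_ite_eq', Finset.sum_ite_eq', ← prefixSum]
  simp only [Finset.mem_filter, Finset.mem_univ, true_and]
  rw [if_pos (show 0 < k by omega)]
  split_ifs
  · omega
  · ring
  · ring
  · omega

/-- If no row of `y` exceeds the sum of the two largest terms, the array with the two largest terms
in the same column dominates. -/
theorem dominated_transposition_of_rows_le (hf0 : ∀ i, 0 ≤ f i) (hd : 2 < d)
    (hy : ∀ S : Finset (Fin 2 × Fin d), ∑ p ∈ S, y p ≤ prefixSum f S.card)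
    (hT : ∑ p, y p = prefixSum f (2 * d)) {b : ℝ} (h : ∀ i, 2 ≤ i → i < 2 * d - 1 → f i = b)
    (hr : ∀ i, ∑ s, y (i, s) ≤ prefixSum f 2) :
    Dominated y (arrangement f (transposition d hd)) := by
  have hrow : ∀ w : Fin 2 × Fin d → ℝ, ∑ i, ∑ s, w (i, s) = ∑ p, w p := fun w =>
    (Fintype.sum_prod_type _).symm
  have hnn : ∀ k, 0 ≤ prefixSum f k := fun k => Finset.sum_nonneg fun i _ => hf0 i
  have hcol1 : ∑ s : Fin d with s.val < 1, (arrangement f (transposition d hd) (0, s) +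
      arrangement f (transposition d hd) (1, s)) = prefixSum f 2 := by
    rw [sum_cols_arrangement_transposition hd le_rfl (by omega), if_pos rfl, prefixSum_succ f d,
      prefixSum_succ f 1]
    ring
  have htwo {k : ℕ} (hk : k ≤ d) : ∃ (K' : Finset (Fin d)) (J' : Finset (Fin 2)),
      K'.card + J'.card = k + 2 ∧
      prefixSum f (2 * d) + prefixSum f (2 * k) ≤ ∑ e ∈ K'.disjSum J',
        lineSums (arrangement f (transposition d hd)) e := by
    -- With `f 0` and `f 1` in one column, the first `k` columns have the largest sum that
    -- majorization allows, `P (2k)`.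
    refine ⟨Finset.univ.filter fun s : Fin d => s.val < k, Finset.univ, ?_, ?_⟩
    · rw [card_filter_val_lt_of_le hk]; rfl
    · rw [sum_lineSums_disjSum, hrow, sum_arrangement]
      rcases Nat.eq_zero_or_pos k with h0 | h0
      · subst h0
        simp [prefixSum_zero]
      rcases (Nat.succ_le_of_lt h0).eq_or_lt with h1 | h1
      · subst h1
        rw [hcol1]
        norm_num [add_comm]
      rw [sum_cols_arrangement_transposition hd h0 hk, if_neg (by omega)]
      rcases hk.eq_or_lt with h2 | h2
      · subst h2
        rw [two_mul]; linarith
      · rw [prefixSum_eq_of_const (m := 2 * k) h (by omega) (by omega),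
          prefixSum_eq_of_const (m := d + k) h (by omega) (by omega),
          prefixSum_eq_of_const (m := k) h (by omega) (by omega),
          prefixSum_eq_of_const (m := d) h (by omega) (by omega)]
        push_cast; linarith
  have hone : ∃ (K' : Finset (Fin d)) (J' : Finset (Fin 2)), K'.card + J'.card = 1 ∧
      prefixSum f 2 ≤ ∑ e ∈ K'.disjSum J', lineSums (arrangement f (transposition d hd)) e := by
    refine ⟨Finset.univ.filter fun s : Fin d => s.val < 1, ∅, ?_, ?_⟩
    · rw [card_filter_val_lt_of_le (by omega)]; rfl
    · rw [sum_lineSums_disjSum, hcol1]; simp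
  refine dominated_of_forall_disjSum fun K J => ?_
  have hK : K.card ≤ d := by simpa using K.card_le_univ
  rcases finset_fin_two_cases J with rfl | ⟨i, rfl⟩ | rfl
  · obtain h0 | h0 | ⟨k, hk⟩ : K.card = 0 ∨ K.card = 1 ∨ ∃ k, K.card = k + 2 := by
      rcases Nat.lt_or_ge K.card 2 with h0 | h0
      · omega
      · exact Or.inr (Or.inr ⟨K.card - 2, by omega⟩)
    · refine ⟨∅, ∅, by simp [h0], ?_⟩
      rw [Finset.card_eq_zero.1 h0]
      simp
    · obtain ⟨K', J', h1, h2⟩ := hone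
      refine ⟨K', J', by rw [h1, h0]; simp, le_trans ?_ h2⟩
      have := sum_cols_le hy K
      rw [h0] at this
      rw [sum_lineSums_disjSum]
      simpa using this
    · obtain ⟨K', J', h1, h2⟩ := htwo (show k ≤ d by omega)
      refine ⟨K', J', by rw [h1, hk]; simp, le_trans ?_ h2⟩
      have := sum_cols_le hy K
      have h3 := prefixSum_mono hf0 (show 2 * K.card ≤ 2 * d by omega)
      rw [sum_lineSums_disjSum, Finset.sum_empty]
      linarith [hnn (2 * k)]
  · obtain h0 | h0 | ⟨k, hk⟩ : K.card = 0 ∨ K.card = 1 ∨ ∃ k, K.card = k + 2 := by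
      rcases Nat.lt_or_ge K.card 2 with h0 | h0
      · omega
      · exact Or.inr (Or.inr ⟨K.card - 2, by omega⟩)
    · obtain ⟨K', J', h1, h2⟩ := hone
      refine ⟨K', J', by rw [h1, h0]; simp, le_trans ?_ h2⟩
      rw [Finset.card_eq_zero.1 h0, sum_lineSums_disjSum]
      simpa using hr i
    · refine ⟨Finset.univ.filter fun s : Fin d => s.val < 1, {0}, ?_, ?_⟩
      · rw [card_filter_val_lt_of_le (by omega), h0]; rfl
      · rw [sum_lineSums_disjSum, sum_lineSums_disjSum, hcol1, Finset.sum_singleton,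
          Finset.sum_singleton, sum_row_zero_arrangement_transposition]
        refine (sum_cols_add_row_le hy K i).trans ?_
        rw [h0, prefixSum_succ f d, prefixSum_succ f 1]
        linarith
    -- One row and `k + 2` columns are matched by both rows and `k + 1` columns: `d + (k + 2) ≤ 2d`
    -- and `k + 2 ≤ 2(k + 1)`.
    · obtain ⟨K', J', h1, h2⟩ := htwo (show k + 1 ≤ d by omega)
      refine ⟨K', J', by rw [h1, hk]; simp, le_trans ?_ h2⟩
      have h3 := sum_cols_add_row_le hy K i
      have h4 := prefixSum_mono hf0 (show d + K.card ≤ 2 * d by omega)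
      have h5 := prefixSum_mono hf0 (show K.card ≤ 2 * (k + 1) by omega)
      rw [sum_lineSums_disjSum, Finset.sum_singleton]
      linarith
  · obtain ⟨K', J', h1, h2⟩ := htwo hK
    refine ⟨K', J', by rw [h1]; simp, le_trans ?_ h2⟩
    rw [sum_lineSums_disjSum, hrow, hT]
    linarith [sum_cols_le hy K]

theorem dominated_or_dominated_transposition (hf : Antitone f) (hf0 : ∀ i, 0 ≤ f i) (hd : 2 < d)
    (hy : ∀ S : Finset (Fin 2 × Fin d), ∑ p ∈ S, y p ≤ prefixSum f S.card)
    (hT : ∑ p, y p = prefixSum f (2 * d)) {b : ℝ} (h : ∀ i, 2 ≤ i → i < 2 * d - 1 → f i = b)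
    (h1 : 2 * ((d : ℝ) - 2) * b + f (2 * d - 1) ≤ f 1) :
    Dominated y (arrangement f (1 : Equiv.Perm (Fin (2 * d)))) ∨
      Dominated y (arrangement f (transposition d hd)) := by
  by_cases hr : ∀ i, ∑ s, y (i, s) ≤ prefixSum f 2
  · exact Or.inr (dominated_transposition_of_rows_le hf0 hd hy hT h hr)
  push Not at hr
  obtain ⟨i, hi⟩ := hr
  refine Or.inl (dominated_arrangement_one hf hf0 hd hy hT fun K h2 h3 => ?_)
  rcases h2.eq_or_lt with h4 | h4
  · right
    -- The row exceeding `P 2` leaves less than `P 1 + P (d + 1) - P 2` for the column. The second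
    -- alternative then amounts to `2(d - 2) b + f (2d - 1) ≤ f 1`, which is exactly `h1`.
    have h5 := sum_cols_add_row_le hy K i
    rw [← h4] at h5 ⊢
    have e0 : prefixSum f 1 = f 0 := by rw [prefixSum_succ, prefixSum_zero, zero_add]
    have e1 : prefixSum f 2 = f 0 + f 1 := by rw [prefixSum_succ, e0]
    have e2 := prefixSum_eq_of_const (m := d + 1) h (by omega) (by omega)
    have e3 := prefixSum_eq_of_const (m := d + 2) h (by omega) (by omega)
    have e4 := prefixSum_eq_of_const (m := 2 * d - 1) h (by omega) le_rfl
    have e5 : prefixSum f (2 * d) = prefixSum f (2 * d - 1) + f (2 * d - 1) := by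
      rw [← prefixSum_succ]; congr 1; omega
    rw [Nat.cast_sub (by omega)] at e4
    push_cast at e2 e3 e4
    norm_num
    rw [e3, e5, e4, e1]
    rw [e2, e1, e0] at h5
    rw [e1] at hi
    nlinarith
  · exact Or.inl (sum_cols_le_of_const hd hy h h4 h3)

end

/-! ### Necessity: transfers that no arrangement dominates. -/

section

variable {d : ℕ} {f : ℕ → ℝ} {x z : Fin 2 × Fin d → ℝ}

theorem transfer_zero (x : Fin 2 × Fin d → ℝ) (s t : Fin d) (δ : ℝ) (r : Fin d) :
    transfer x s t δ (0, r) = x (0, r) - if r = s then δ else 0 := by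
  simp [transfer]

theorem transfer_one (x : Fin 2 × Fin d → ℝ) (s t : Fin d) (δ : ℝ) (r : Fin d) :
    transfer x s t δ (1, r) = x (1, r) + if r = t then δ else 0 := by
  simp [transfer]

theorem sum_row_zero_transfer (x : Fin 2 × Fin d → ℝ) (s t : Fin d) (δ : ℝ) :
    ∑ r, transfer x s t δ (0, r) = ∑ r, x (0, r) - δ := by
  simp [transfer_zero, Finset.sum_sub_distrib]

/-- With equal totals, an upper bound on the complementary lines is a lower bound on the given ones:
the dominating array also has the smaller small lines. -/
theorem Dominated.compl (h : Dominated x z) (ht : ∑ p, x p = ∑ p, z p)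
    (S : Finset (Fin d ⊕ Fin 2)) : ∃ S' : Finset (Fin d ⊕ Fin 2), S'.card = S.card ∧
      ∑ e ∈ S', lineSums z e ≤ ∑ e ∈ S, lineSums x e := by
  obtain ⟨S', h1, h2⟩ := h Sᶜ
  have e1 := Finset.sum_add_sum_compl S (lineSums x)
  have e2 := Finset.sum_add_sum_compl S' (lineSums z)
  rw [sum_lineSums] at e1 e2
  refine ⟨S'ᶜ, ?_, by linarith⟩
  have := S.card_le_univ
  have := S'.card_le_univ
  rw [Finset.card_compl] at h1 ⊢
  omega

theorem sum_arrangement_le (hf : Antitone f) (π : Equiv.Perm (Fin (2 * d)))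
    (A : Finset (Fin 2 × Fin d)) : ∑ p ∈ A, arrangement f π p ≤ prefixSum f A.card := by
  let e : Fin 2 × Fin d ↪ ℕ := (finProdFinEquiv.trans π).toEmbedding.trans Fin.valEmbedding
  have := sum_le_sum_range_card hf (A.map e)
  rw [Finset.sum_map, Finset.card_map] at this
  exact this

theorem sum_row_subset_le (hf : Antitone f) (π : Equiv.Perm (Fin (2 * d))) (i : Fin 2)
    (K : Finset (Fin d)) : ∑ s ∈ K, arrangement f π (i, s) ≤ prefixSum f K.card := by
  have := sum_arrangement_le hf π ({i} ×ˢ K)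
  rwa [Finset.sum_product, Finset.sum_singleton, Finset.card_product, Finset.card_singleton,
    one_mul] at this

theorem sum_row_le (hf : Antitone f) (π : Equiv.Perm (Fin (2 * d))) (i : Fin 2) :
    ∑ s, arrangement f π (i, s) ≤ prefixSum f d := by
  simpa using sum_row_subset_le hf π i Finset.univ

theorem fin_two_ne_one_sub (i : Fin 2) : i ≠ 1 - i := by
  revert i; decide

theorem fin_two_eq_one_sub_of_ne {i j : Fin 2} (h : i ≠ j) : j = 1 - i := by
  revert i j; decide

theorem column_eq_add (π : Equiv.Perm (Fin (2 * d))) (i : Fin 2) (s : Fin d) :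
    arrangement f π (0, s) + arrangement f π (1, s) =
      arrangement f π (i, s) + arrangement f π (1 - i, s) := by
  fin_cases i
  · simp
  · simp [add_comm]

/-- A column has two cells, so its sum is at most `P 2` and it cannot match a line larger than that.
-/
theorem exists_row_of_dominated (hf : Antitone f) {π : Equiv.Perm (Fin (2 * d))}
    (h : Dominated x (arrangement f π)) {v : ℝ} (hv : ∑ s, x (0, s) = v) (h2 : prefixSum f 2 < v) :
    ∃ i, v ≤ ∑ s, arrangement f π (i, s) := by
  obtain ⟨S', h3, h4⟩ := h {Sum.inr 0}
  rw [Finset.card_singleton, Finset.card_eq_one] at h3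
  obtain ⟨e, rfl⟩ := h3
  rw [Finset.sum_singleton, Finset.sum_singleton] at h4
  rcases e with s | i
  · exfalso
    have := sum_arrangement_le hf π (Finset.univ ×ˢ {s})
    rw [Finset.sum_product_right, Finset.sum_singleton, Finset.card_product,
      Finset.card_singleton, Finset.card_univ, Fintype.card_fin] at this
    have h5 : v ≤ ∑ i, arrangement f π (i, s) := hv ▸ h4
    norm_num at this
    rw [Fin.sum_univ_two] at h5
    linarith
  · exact ⟨i, hv ▸ h4⟩

theorem prefixSum_two_mul_eq_add {d : ℕ} (hd : 2 < d) (f : ℕ → ℝ) :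
    prefixSum f (2 * d) = prefixSum f (2 * d - 2) + f (2 * d - 2) + f (2 * d - 1) := by
  rw [← prefixSum_succ, show 2 * d - 2 + 1 = 2 * d - 1 by omega, ← prefixSum_succ]
  congr 1; omega

/-- A generic `δ` is moved from the last cell of the sorted top row to the column on its left. A
dominating arrangement needs a row of sum at least `P d - δ` and a line no larger than the depleted
column; together they would force one of its entries to equal `f (d - 1) - δ`, which genericity
excludes. -/
theorem arrangement_const_of_forall_dominated (hf : Antitone f) (hf0 : ∀ i, 0 ≤ f i) (hd : 2 < d)
    (H : ∀ s t : Fin d, s ≠ t → ∀ δ : ℝ, 0 ≤ δ →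
      δ ≤ arrangement f (1 : Equiv.Perm (Fin (2 * d))) (0, s) -
        arrangement f (1 : Equiv.Perm (Fin (2 * d))) (1, t) →
      ∃ π : Equiv.Perm (Fin (2 * d)),
        Dominated (transfer (arrangement f (1 : Equiv.Perm (Fin (2 * d)))) s t δ)
          (arrangement f π))
    (hpos : 0 < f d) : f (d - 1) = f (2 * d - 2) := by
  by_contra hne
  have hlt : f (2 * d - 2) < f (d - 1) := lt_of_le_of_ne (hf (by omega)) (Ne.symm hne)
  have hT := prefixSum_two_mul_eq_add hd f
  have hm := prefixSum_mono hf0 (show d + 1 ≤ 2 * d - 2 by omega)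
  rw [prefixSum_succ] at hm
  set L := max 0 (f (d - 1) + f (2 * d - 1) - (prefixSum f (2 * d) - prefixSum f d)) with hL
  have hLR : L < f (d - 1) - f (2 * d - 2) := by
    rw [hL, max_lt_iff]
    constructor <;> linarith
  -- The lower end of the interval prevents the small line from being a row; the upper end is the
  -- largest transfer available. Only finitely many values of `δ` are excluded.
  obtain ⟨δ, hδ, hδn⟩ := (Set.Ioo_infinite hLR).exists_notMem_finset
    (Finset.univ.image fun j : Fin (2 * d) => f (d - 1) - f j)
  obtain ⟨hδ1, hδ2⟩ := hδ
  have hδ0 : 0 < δ := (le_max_left _ _).trans_lt hδ1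
  have hδ3 : f (d - 1) + f (2 * d - 1) - (prefixSum f (2 * d) - prefixSum f d) < δ :=
    (le_max_right _ _).trans_lt hδ1
  let s : Fin d := ⟨d - 1, by omega⟩
  let t : Fin d := ⟨d - 2, by omega⟩
  have hst : s ≠ t := by simp only [s, t, ne_eq, Fin.mk.injEq]; omega
  have hs0 : arrangement f (1 : Equiv.Perm (Fin (2 * d))) (0, s) = f (d - 1) :=
    arrangement_one_zero s
  have hs1 : arrangement f (1 : Equiv.Perm (Fin (2 * d))) (1, s) = f (2 * d - 1) := by
    rw [arrangement_one_one]; congr 1; simp only [s]; omega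
  have ht1 : arrangement f (1 : Equiv.Perm (Fin (2 * d))) (1, t) = f (2 * d - 2) := by
    rw [arrangement_one_one]; congr 1; simp only [t]; omega
  obtain ⟨π, hπ⟩ := H s t hst δ hδ0.le (by rw [hs0, ht1]; exact hδ2.le)
  have hSd : prefixSum f d = prefixSum f (d - 1) + f (d - 1) := by
    rw [← prefixSum_succ]; congr 1; omega
  have h2 := prefixSum_mono hf0 (show 2 ≤ d - 1 by omega)
  obtain ⟨i, hi⟩ := exists_row_of_dominated hf hπ
    (by rw [sum_row_zero_transfer, sum_row_zero_arrangement_one]) (by linarith [hf0 (2 * d - 2)])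
  obtain ⟨S', h3, h4⟩ := hπ.compl (by rw [sum_transfer, sum_arrangement, sum_arrangement])
    {Sum.inl s}
  rw [Finset.card_singleton, Finset.card_eq_one] at h3
  obtain ⟨e, rfl⟩ := h3
  have hx : lineSums (transfer (arrangement f (1 : Equiv.Perm (Fin (2 * d)))) s t δ) (Sum.inl s) =
      f (d - 1) + f (2 * d - 1) - δ := by
    simp only [lineSums, Sum.elim_inl, Fin.sum_univ_two]
    rw [transfer_zero, transfer_one, if_pos rfl, if_neg hst, hs0, hs1]
    ring
  rw [Finset.sum_singleton, Finset.sum_singleton, hx] at h4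
  rcases e with r | j
  · have h5 : arrangement f π (i, r) + arrangement f π (1 - i, r) ≤
        f (d - 1) + f (2 * d - 1) - δ := by
      rw [← column_eq_add]
      simpa [lineSums, Fin.sum_univ_two] using h4
    have h6 : f (2 * d - 1) ≤ arrangement f π (1 - i, r) :=
      hf (by have := (π (finProdFinEquiv (1 - i, r))).2; omega)
    have h7 := sum_row_subset_le hf π i (Finset.univ.erase r)
    rw [Finset.card_erase_of_mem (Finset.mem_univ _), Finset.card_univ, Fintype.card_fin] at h7
    have h8 := Finset.add_sum_erase Finset.univ (fun s => arrangement f π (i, s))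
      (Finset.mem_univ r)
    apply hδn
    rw [Finset.mem_image]
    refine ⟨π (finProdFinEquiv (i, r)), Finset.mem_univ _, ?_⟩
    -- The small column gives `≤`. The row sum gives `≥`, since the other `d - 1` entries of the row
    -- contribute at most `P (d - 1)`.
    have h9 : arrangement f π (i, r) = f (d - 1) - δ := by linarith
    rw [arrangement] at h9
    rw [h9]; ring
  · have h5 : ∑ s, arrangement f π (j, s) ≤ f (d - 1) + f (2 * d - 1) - δ := h4
    have h6 := sum_row_add_sum_row (arrangement f π) j
    rw [sum_arrangement] at h6
    linarith [sum_row_le hf π (1 - j)]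

/-- The transfer leaves `d + 2 - r` columns of total mass below the least positive eigenvalue. In a
dominating arrangement as many lines must vanish, and its large row then has too few nonzero cells.
-/
theorem not_forall_dominated_of_rank_le (hf : Antitone f) (hf0 : ∀ i, 0 ≤ f i)
    {r : ℕ} (hr4 : 4 ≤ r) (hrd : r ≤ d) (hpos : 0 < f (r - 1)) (hz : ∀ i, r ≤ i → f i = 0)
    (H : ∀ σ : Equiv.Perm (Fin (2 * d)), ∀ s t : Fin d, s ≠ t → ∀ δ : ℝ, 0 ≤ δ →
      δ ≤ arrangement f σ (0, s) - arrangement f σ (1, t) →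
      ∃ π : Equiv.Perm (Fin (2 * d)),
        Dominated (transfer (arrangement f σ) s t δ) (arrangement f π)) : False := by
  -- The least positive eigenvalue goes below the largest one; the other `r - 1` stay in the top
  -- row.
  let σ : Equiv.Perm (Fin (2 * d)) := Equiv.swap ⟨r - 1, by omega⟩ ⟨d, by omega⟩
  have hσ0 (s : Fin d) : arrangement f σ (0, s) =
      f s - if s = (⟨r - 1, by omega⟩ : Fin d) then f (r - 1) else 0 := by
    simp only [arrangement, σ, Equiv.swap_apply_def, Fin.ext_iff, finProdFinEquiv_apply_val]
    have := s.2
    simp only [Fin.val_zero, mul_zero, add_zero]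
    split_ifs with h1 h2
    · rw [h1]; simp [hz d hrd]
    · omega
    · simp
  have hσ1 (s : Fin d) : arrangement f σ (1, s) = if s.val = 0 then f (r - 1) else 0 := by
    simp only [arrangement, σ, Equiv.swap_apply_def, Fin.ext_iff, finProdFinEquiv_apply_val]
    have := s.2
    simp only [Fin.val_one, mul_one]
    split_ifs with h1 h2 h3 h4 h5
    · omega
    · omega
    · rfl
    · omega
    · omega
    · exact hz _ (by simp; omega)
  let s : Fin d := ⟨r - 2, by omega⟩
  let t : Fin d := ⟨1, by omega⟩
  have hst : s ≠ t := by simp only [s, t, ne_eq, Fin.mk.injEq]; omega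
  have hsv : s.val = r - 2 := rfl
  have htv : t.val = 1 := rfl
  have hs0 : arrangement f σ (0, s) = f (r - 2) := by
    rw [hσ0, if_neg (by simp only [s, Fin.mk.injEq]; omega), sub_zero]
  have ht1 : arrangement f σ (1, t) = 0 := by rw [hσ1, if_neg (by simp [t])]
  have hr12 : f (r - 1) ≤ f (r - 2) := hf (by omega)
  -- Only `f (r - 1) / 2` remains in the source cell: positive, so the top row exceeds `P (r - 2)`,
  -- and smaller than every nonzero entry of an arrangement.
  obtain ⟨π, hπ⟩ := H σ s t hst (f (r - 2) - f (r - 1) / 2) (by linarith)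
    (by rw [hs0, ht1]; linarith)
  have hp1 : prefixSum f (r - 1) = prefixSum f (r - 2) + f (r - 2) := by
    rw [← prefixSum_succ]; congr 1; omega
  have hp0 : prefixSum f r = prefixSum f (r - 1) + f (r - 1) := by
    rw [← prefixSum_succ]; congr 1; omega
  have hconst : ∀ m, r ≤ m → prefixSum f m = prefixSum f r := fun m hm => by
    rw [prefixSum_eq_of_const (c := m) (fun i hi _ => hz i hi) hm le_rfl]; ring
  have hrow : ∑ p, arrangement f σ (0, p) = prefixSum f r - f (r - 1) := by
    simp only [hσ0]
    rw [Finset.sum_sub_distrib, Finset.sum_ite_eq', if_pos (Finset.mem_univ _),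
      Fin.sum_univ_eq_sum_range f d, ← hconst d hrd]
    rfl
  obtain ⟨i, hi⟩ := exists_row_of_dominated (v := prefixSum f (r - 2) + f (r - 1) / 2) hf hπ
    (by rw [sum_row_zero_transfer, hrow]; linarith)
    (by linarith [prefixSum_mono hf0 (show 2 ≤ r - 2 by omega)])
  set E : Finset (Fin d) := (Finset.univ.filter fun q => q.val < r - 2)ᶜ with hE
  have hEc : E.card = d + 2 - r := by
    rw [hE, Finset.card_compl, card_filter_val_lt_of_le (by omega), Fintype.card_fin]
    omega
  obtain ⟨S', h3, h4⟩ := hπ.compl (by rw [sum_transfer, sum_arrangement, sum_arrangement])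
    (E.disjSum ∅)
  have hEx : ∑ e ∈ E.disjSum ∅,
      lineSums (transfer (arrangement f σ) s t (f (r - 2) - f (r - 1) / 2)) e = f (r - 1) / 2 := by
    rw [sum_lineSums_disjSum, Finset.sum_empty, add_zero, Finset.sum_eq_single s]
    · rw [transfer_zero, transfer_one, if_pos rfl, if_neg hst, hs0, hσ1,
        if_neg (by omega)]
      ring
    · intro q hq hqs
      have hq1 : ¬ q.val < r - 2 := by simpa [hE] using hq
      have hq2 : q.val ≠ r - 2 := fun h => hqs (Fin.ext h)
      rw [transfer_zero, transfer_one, if_neg hqs, if_neg (by rw [Fin.ext_iff]; omega),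
        hσ0, hσ1, if_neg (show ¬ q.val = 0 by omega)]
      split_ifs with h
      · rw [h]; ring
      · rw [hz q]
        · ring
        · have : q.val ≠ r - 1 := fun h' => h (Fin.ext h')
          omega
    · intro h
      exact absurd (by
        simp only [hE, Finset.mem_compl, Finset.mem_filter, Finset.mem_univ, true_and]; omega) h
  rw [hEx] at h4
  rw [Finset.card_disjSum, Finset.card_empty, hEc, add_zero] at h3
  have hz0 : ∀ p, 0 ≤ arrangement f π p := fun p => hf0 _
  have hl0 : ∀ e, 0 ≤ lineSums (arrangement f π) e := fun e => by
    rcases e with q | j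
    · exact (Finset.sum_nonneg fun j _ => hz0 (j, q) : 0 ≤ ∑ j, arrangement f π (j, q))
    · exact (Finset.sum_nonneg fun q _ => hz0 (j, q) : 0 ≤ ∑ q, arrangement f π (j, q))
  have hzero : ∀ p, arrangement f π p ≤ f (r - 1) / 2 → arrangement f π p = 0 := fun p hp => by
    by_cases h : r ≤ (π (finProdFinEquiv p)).val
    · exact hz _ h
    · have : f (r - 1) ≤ arrangement f π p := hf (by omega)
      linarith
  have hline : ∀ e ∈ S', lineSums (arrangement f π) e ≤ f (r - 1) / 2 := fun e he =>
    (Finset.single_le_sum (fun e _ => hl0 e) he).trans h4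
  have hcol : ∀ q ∈ S'.toLeft, arrangement f π (i, q) = 0 := fun q hq => by
    refine hzero _ ((Finset.single_le_sum (f := fun i => arrangement f π (i, q))
      (fun j _ => hz0 (j, q)) (Finset.mem_univ i)).trans ?_)
    exact hline _ (Finset.mem_toLeft.1 hq)
  have hrows : ∀ j ∈ S'.toRight, ∑ q, arrangement f π (j, q) = 0 := fun j hj => by
    refine Finset.sum_eq_zero fun q _ => hzero _ ((Finset.single_le_sum
      (f := fun q => arrangement f π (j, q)) (fun q _ => hz0 (j, q)) (Finset.mem_univ q)).trans ?_)
    exact hline _ (Finset.mem_toRight.1 hj)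
  have hcard : S'.toLeft.card + S'.toRight.card = d + 2 - r := by
    rw [Finset.card_toLeft_add_card_toRight, h3]
  have hsup : ∑ q, arrangement f π (i, q) ≤ prefixSum f (d - S'.toLeft.card) := by
    rw [← Finset.sum_add_sum_compl S'.toLeft, Finset.sum_eq_zero hcol, zero_add]
    have := sum_row_subset_le hf π i S'.toLeftᶜ
    rwa [Finset.card_compl, Fintype.card_fin] at this
  have hnn : 0 ≤ prefixSum f (r - 2) := Finset.sum_nonneg fun i _ => hf0 i
  have hij : i ∉ S'.toRight := fun h => by
    have := hrows i h
    linarith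
  -- Without a vanishing row, row `i` lives on `r - 2` cells and is too small. If the other row
  -- vanishes, all the mass `P r` must fit into `r - 1` cells. Row `i` itself is not zero.
  rcases finset_fin_two_cases S'.toRight with h5 | ⟨j, h5⟩ | h5
  · rw [h5, Finset.card_empty] at hcard
    rw [show d - S'.toLeft.card = r - 2 by omega] at hsup
    linarith
  · rw [h5, Finset.card_singleton] at hcard
    rw [show d - S'.toLeft.card = r - 1 by omega] at hsup
    have hj : j = 1 - i := fin_two_eq_one_sub_of_ne fun h => by simp [h5, h] at hij
    have h6 := hrows j (by rw [h5]; exact Finset.mem_singleton_self _)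
    have h7 := sum_row_add_sum_row (arrangement f π) i
    rw [← hj, h6, sum_arrangement, hconst _ (by omega)] at h7
    linarith
  · exact hij (h5 ▸ Finset.mem_univ i)

/-- Here `δ` is moved from the last cell above the plateau to the cell below `f 0`. The large row of
a dominating arrangement must hold every entry above `b`, so any `k` of its columns sum to at most
`P k + k b`; the first `h - 1` columns after the transfer, taken with both rows, violate this. -/
theorem not_forall_dominated_of_const (hf : Antitone f) (hf0 : ∀ i, 0 ≤ f i) (hd : 2 < d)
    {h : ℕ} (h2 : 2 ≤ h) (hhd : h < d) {b : ℝ} (hb : ∀ i, h ≤ i → i < 2 * d - 1 → f i = b)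
    (hbpos : 0 < b) (hlt : b < f (h - 1)) (hdc : 0 < ((d : ℝ) - 3) * b + f (2 * d - 1))
    (hh : 3 ≤ h ∨ f 1 < 2 * ((d : ℝ) - 2) * b + f (2 * d - 1))
    (H : ∀ s t : Fin d, s ≠ t → ∀ δ : ℝ, 0 ≤ δ →
      δ ≤ arrangement f (1 : Equiv.Perm (Fin (2 * d))) (0, s) -
        arrangement f (1 : Equiv.Perm (Fin (2 * d))) (1, t) →
      ∃ π : Equiv.Perm (Fin (2 * d)),
        Dominated (transfer (arrangement f (1 : Equiv.Perm (Fin (2 * d)))) s t δ)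
          (arrangement f π)) : False := by
  have hd3 : (3 : ℝ) ≤ d := by exact_mod_cast hd
  have hb1 : ∀ i, i ≤ h → b ≤ f i := fun i hi => by
    rw [← hb h le_rfl (by omega)]; exact hf hi
  have hfh : f h = b := hb h le_rfl (by omega)
  have hTd : prefixSum f (2 * d) = prefixSum f d + ((d : ℝ) - 1) * b + f (2 * d - 1) := by
    have e1 := prefixSum_eq_of_const (m := 2 * d - 1) hb (by omega) le_rfl
    have e2 := prefixSum_eq_of_const (m := d) hb (by omega) (by omega)
    have e3 : prefixSum f (2 * d) = prefixSum f (2 * d - 1) + f (2 * d - 1) := by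
      rw [← prefixSum_succ]; congr 1; omega
    rw [e3, e1, e2, Nat.cast_sub (by omega)]
    push_cast; ring
  have hp1 : prefixSum f h = prefixSum f (h - 1) + f (h - 1) := by
    rw [← prefixSum_succ]; congr 1; omega
  have hp2 : prefixSum f (h + 1) = prefixSum f h + b := by rw [prefixSum_succ, hfh]
  have hpd1 : prefixSum f (d + 1) = prefixSum f d + b := by
    rw [prefixSum_succ, hb d (by omega) (by omega)]
  have htwo : 2 * b ≤ prefixSum f 2 := by
    rw [prefixSum_succ, prefixSum_succ, prefixSum_zero]
    linarith [hb1 0 (by omega), hb1 1 (by omega)]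
  have h2d := prefixSum_mono hf0 (show 3 ≤ d by omega)
  rw [prefixSum_succ] at h2d
  have hd2 : prefixSum f 2 < prefixSum f d := by
    have : b ≤ f 2 := hb1 2 (by omega)
    linarith
  -- The second lower bound defeats selections of one row and `h` columns. It lies below `f (h - 1)
  -- - b` by `hdc` and below `P d - P 2` by `hh`; the latter bound keeps the top row above `P 2`.
  have hLR : max 0 (f (h - 1) - ((d : ℝ) - 2) * b - f (2 * d - 1)) <
      min (f (h - 1) - b) (prefixSum f d - prefixSum f 2) := by
    rw [max_lt_iff, lt_min_iff, lt_min_iff]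
    refine ⟨⟨by linarith, by linarith⟩, by linarith, ?_⟩
    have h0 := hf0 (2 * d - 1)
    have h1 : 0 < ((d : ℝ) - 2) * b := mul_pos (by linarith) hbpos
    rcases Nat.lt_or_ge h 3 with h3 | h3
    · have h4 : h = 2 := by omega
      subst h4
      have h5 := hh.resolve_left (by omega)
      have e2 := prefixSum_eq_of_const (m := d) hb (by omega) (by omega)
      push_cast at e2
      norm_num
      linarith
    · have : f (h - 1) ≤ f 2 := hf (by omega)
      linarith
  obtain ⟨δ, hδ1, hδ2⟩ := exists_between hLR
  rw [max_lt_iff] at hδ1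
  rw [lt_min_iff] at hδ2
  let s : Fin d := ⟨h - 1, by omega⟩
  let t : Fin d := ⟨0, by omega⟩
  have hst : s ≠ t := by simp only [s, t, ne_eq, Fin.mk.injEq]; omega
  have hs0 : arrangement f (1 : Equiv.Perm (Fin (2 * d))) (0, s) = f (h - 1) :=
    arrangement_one_zero s
  have ht1 : arrangement f (1 : Equiv.Perm (Fin (2 * d))) (1, t) = b := by
    rw [arrangement_one_one]; exact hb _ (by simp [t]; omega) (by simp [t]; omega)
  obtain ⟨π, hπ⟩ := H s t hst δ hδ1.1.le (by rw [hs0, ht1]; exact hδ2.1.le)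
  obtain ⟨i, hi⟩ := exists_row_of_dominated hf hπ
    (by rw [sum_row_zero_transfer, sum_row_zero_arrangement_one]) (by linarith [hδ2.2])
  -- An entry above the plateau in the other row, added to row `i`, would exceed `P (d + 1) = P d +
  -- b`, because `δ < f (h - 1) - b`.
  have hsmall : ∀ q, arrangement f π (1 - i, q) ≤ b := by
    intro q
    by_cases hq : h ≤ (π (finProdFinEquiv (1 - i, q))).val
    · exact (hf hq).trans hfh.le
    · exfalso
      have h3 : f (h - 1) ≤ arrangement f π (1 - i, q) := hf (by omega)
      have h4 : (1 - i, q) ∉ ({i} : Finset (Fin 2)) ×ˢ (Finset.univ : Finset (Fin d)) := by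
        simp [eq_comm, fin_two_ne_one_sub i]
      have h5 := sum_arrangement_le hf π (insert (1 - i, q) ({i} ×ˢ Finset.univ))
      rw [Finset.sum_insert h4, Finset.card_insert_of_notMem h4, Finset.sum_product,
        Finset.sum_singleton, Finset.card_product, Finset.card_singleton, Finset.card_univ,
        Fintype.card_fin, one_mul, hpd1] at h5
      linarith [hδ2.1]
  have hcols : ∀ K : Finset (Fin d), ∑ q ∈ K, (arrangement f π (0, q) + arrangement f π (1, q)) ≤
      prefixSum f K.card + K.card * b := by
    intro K
    simp only [column_eq_add π i]
    rw [Finset.sum_add_distrib]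
    refine add_le_add (sum_row_subset_le hf π i K) ?_
    simpa using Finset.sum_le_card_nsmul K _ b fun q _ => hsmall q
  have hrow : ∀ w : Fin 2 × Fin d → ℝ, ∑ i, ∑ s, w (i, s) = ∑ p, w p := fun w =>
    (Fintype.sum_prod_type _).symm
  set F : Finset (Fin d) := Finset.univ.filter fun q => q.val < h - 1 with hF
  have hFc : F.card = h - 1 := card_filter_val_lt_of_le (by omega)
  obtain ⟨S', h3, h4⟩ := hπ (F.disjSum Finset.univ)
  have hx : ∑ e ∈ F.disjSum Finset.univ,
      lineSums (transfer (arrangement f (1 : Equiv.Perm (Fin (2 * d)))) s t δ) e =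
      prefixSum f (2 * d) + prefixSum f (h - 1) + ((h : ℝ) - 1) * b + δ := by
    rw [sum_lineSums_disjSum, hrow, sum_transfer, sum_arrangement]
    have e1 : ∑ q ∈ F, (transfer (arrangement f (1 : Equiv.Perm (Fin (2 * d)))) s t δ (0, q) +
        transfer (arrangement f (1 : Equiv.Perm (Fin (2 * d)))) s t δ (1, q)) =
        ∑ q ∈ F, (arrangement f (1 : Equiv.Perm (Fin (2 * d))) (0, q) +
          arrangement f (1 : Equiv.Perm (Fin (2 * d))) (1, q)) + δ := by
      simp only [transfer_zero, transfer_one]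
      rw [Finset.sum_add_distrib, Finset.sum_sub_distrib, Finset.sum_add_distrib,
        Finset.sum_add_distrib, Finset.sum_ite_eq', Finset.sum_ite_eq',
        if_neg (by simp [hF, s]), if_pos (by simp [hF, t]; omega)]
      ring
    rw [e1, sum_cols_arrangement_one (by omega),
      prefixSum_eq_of_const (m := d + (h - 1)) hb (by omega) (by omega),
      prefixSum_eq_of_const (m := d) hb (by omega) (by omega)]
    push_cast [Nat.cast_sub (show 1 ≤ h by omega)]
    ring
  rw [hx, ← Finset.toLeft_disjSum_toRight (u := S'), sum_lineSums_disjSum] at h4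
  rw [← Finset.card_toLeft_add_card_toRight, Finset.card_disjSum, hFc, Finset.card_univ,
    Fintype.card_fin] at h3
  have h5 := hcols S'.toLeft
  rcases finset_fin_two_cases S'.toRight with h6 | ⟨j, h6⟩ | h6
  · rw [h6, Finset.card_empty] at h3
    rw [h6, Finset.sum_empty] at h4
    rw [show S'.toLeft.card = h + 1 by omega] at h5
    push_cast at h5
    linarith [hδ1.2]
  · rw [h6, Finset.card_singleton] at h3
    rw [h6, Finset.sum_singleton] at h4
    rw [show S'.toLeft.card = h by omega] at h5
    linarith [hδ1.2, sum_row_le hf π j]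
  · rw [h6, Finset.card_univ, Fintype.card_fin] at h3
    rw [h6, hrow, sum_arrangement] at h4
    rw [show S'.toLeft.card = h - 1 by omega, Nat.cast_sub (by omega)] at h5
    push_cast at h5
    linarith [hδ1.1]

end

/-! ### Assembling the characterization. -/

theorem swapP_mul_diagEig_mul_swapP {d : ℕ} (hd : 2 < d)
    {C : Matrix (Fin 2 × Fin d) (Fin 2 × Fin d) ℂ} (hC : C.IsHermitian) :
    swapP d hd * diagEig C hC 1 * swapP d hd = diagEig C hC (transposition d hd) := by
  have h : ∀ p : Fin 2 × Fin d,
      finProdFinEquiv ((Equiv.swap (finProdFinEquiv.symm (⟨1, by omega⟩ : Fin (2 * d)))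
        (finProdFinEquiv.symm ⟨d, by omega⟩)) p) =
      transposition d hd (finProdFinEquiv p) := fun p => by
    rw [finProdFinEquiv.injective.map_swap, Equiv.apply_symm_apply, Equiv.apply_symm_apply]
    rfl
  rw [swapP, Matrix.swap, PEquiv.toMatrix_toPEquiv_mul, PEquiv.mul_toMatrix_toPEquiv,
    submatrix_submatrix, Equiv.symm_swap, Function.id_comp, Function.comp_id, diagEig,
    submatrix_diagonal_equiv, diagEig]
  congr 1
  ext p
  simp only [Function.comp_apply, h, Equiv.Perm.one_apply]

theorem specPtraceSum_congr {m n : Type*} [Fintype m] [Fintype n] [DecidableEq m] [DecidableEq n]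
    {X Y : Matrix (m × n) (m × n) ℂ} (hX : X.IsHermitian) (hY : Y.IsHermitian) (h : X = Y) :
    specPtraceSum X hX = specPtraceSum Y hY := by
  subst h; rfl

/-- The cases of the characterization, for a nonincreasing sequence `f` with `r` positive terms. -/
theorem spectrum_cases_of_forall_dominated {d : ℕ} {f : ℕ → ℝ} (hf : Antitone f)
    (hf0 : ∀ i, 0 ≤ f i) (hd : 2 < d) {r : ℕ} (hr : ∀ k, 0 < f k ↔ k < r) (hr2 : r ≤ 2 * d)
    (H : ∀ σ : Equiv.Perm (Fin (2 * d)), ∀ s t : Fin d, s ≠ t → ∀ δ : ℝ, 0 ≤ δ →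
      δ ≤ arrangement f σ (0, s) - arrangement f σ (1, t) →
      ∃ π : Equiv.Perm (Fin (2 * d)),
        Dominated (transfer (arrangement f σ) s t δ) (arrangement f π)) :
    r ≤ 3 ∨ (r = 2 * d - 1 ∨ r = 2 * d) ∧ ((∀ i, 1 ≤ i → i < 2 * d - 1 → f i = f 1) ∨
      ((∀ i, 2 ≤ i → i < 2 * d - 1 → f i = f 2) ∧
        2 * ((d : ℝ) - 2) * f 2 + f (2 * d - 1) ≤ f 1) ∨
      (d = 3 ∧ r = 5 ∧ f 2 = f 3 ∧ f 3 = f 4)) := by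
  refine or_iff_not_imp_left.2 fun hr3 => ?_
  have hrd : d < r := by
    by_contra hrd
    refine not_forall_dominated_of_rank_le hf hf0 (r := r) (by omega) (by omega)
      ((hr _).2 (by omega)) (fun i hi => ?_) H
    exact le_antisymm (not_lt.1 fun h => by have := (hr i).1 h; omega) (hf0 i)
  have hA := arrangement_const_of_forall_dominated hf hf0 hd (H 1) ((hr d).2 hrd)
  obtain ⟨b, hb⟩ : ∃ b, b = f (2 * d - 2) := ⟨_, rfl⟩
  have hbpos : 0 < b := by
    rw [hb, ← hA]; exact (hr _).2 (by omega)
  have hrr : r = 2 * d - 1 ∨ r = 2 * d := by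
    have := (hr (2 * d - 2)).1 (hb ▸ hbpos)
    omega
  refine ⟨hrr, ?_⟩
  classical
  -- The least such index `h` is the left end of the plateau; it decides between the cases.
  have hex : ∃ h, f h = b := ⟨d - 1, by rw [hA, hb]⟩
  obtain ⟨h, hh⟩ : ∃ h, h = Nat.find hex := ⟨_, rfl⟩
  have hfh : f h = b := hh ▸ Nat.find_spec hex
  have hhd : h ≤ d - 1 := hh ▸ Nat.find_min' hex (by rw [hA, hb])
  have hconst : ∀ i, h ≤ i → i < 2 * d - 1 → f i = b := fun i h1 h2 =>
    le_antisymm (hfh ▸ hf h1) (by rw [hb]; exact hf (by omega))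
  by_cases h1 : h ≤ 1
  · left
    intro i hi hi2
    rw [hconst i (by omega) hi2, hconst 1 h1 (by omega)]
  right
  have hlt : b < f (h - 1) := by
    refine lt_of_le_of_ne (hfh ▸ hf (by omega)) fun h2 => ?_
    exact Nat.find_min hex (m := h - 1) (by omega) h2.symm
  by_cases h2 : h = 2 ∧ 2 * ((d : ℝ) - 2) * b + f (2 * d - 1) ≤ f 1
  · left
    obtain ⟨rfl, h2⟩ := h2
    rw [hfh]
    exact ⟨hconst, h2⟩
  right
  -- As `b > 0`, failure of strict positivity leaves only `d = 3` with `f 5 = 0`, which is the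
  -- fourth case.
  have hdc : ((d : ℝ) - 3) * b + f (2 * d - 1) ≤ 0 := by
    by_contra hdc
    refine not_forall_dominated_of_const hf hf0 hd (by omega) (by omega) hconst hbpos hlt
      (not_le.1 hdc) ?_ (H 1)
    rcases Nat.lt_or_ge h 3 with h3 | h3
    · exact Or.inr (not_le.1 fun h4 => h2 ⟨by omega, h4⟩)
    · exact Or.inl h3
  have hd3 : d = 3 := by
    by_contra hd3
    have : (4 : ℝ) ≤ d := by exact_mod_cast (show 4 ≤ d by omega)
    nlinarith [hf0 (2 * d - 1)]
  subst hd3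
  norm_num at hdc hhd
  have h5 : ¬ 5 < r := fun h => by linarith [(hr 5).2 h]
  have h6 : h = 2 := by omega
  subst h6
  exact ⟨rfl, by omega, by rw [hfh, hconst 3 (by omega) (by omega)],
    by rw [hconst 3 (by omega) (by omega), hconst 4 (by omega) (by omega)]⟩

section

variable {d : ℕ} {C : Matrix (Fin 2 × Fin d) (Fin 2 × Fin d) ℂ}

theorem eig_eq_eigSeq (hC : C.IsHermitian) {k : ℕ} (hk : 1 ≤ k) :
    eig C hC k = eigSeq C hC (k - 1) := by
  rw [eigSeq, Nat.sub_add_cancel hk]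

theorem eigSeq_eq_zero_of_rank_le (hC : C.PosSemidef) {i : ℕ} (hi : C.rank ≤ i) :
    eigSeq C hC.isHermitian i = 0 :=
  le_antisymm (not_lt.1 fun h => (hi.trans_lt ((eigSeq_pos_iff hC i).1 h)).false)
    (eigSeq_nonneg hC i)

theorem conj_majorized_of_rank_le_three (hd : 2 < d) (hC : C.PosSemidef) (h : C.rank ≤ 3)
    (U : Matrix.unitaryGroup (Fin 2 × Fin d) ℂ) :
      specPtraceSum (U.val * C * U.valᴴ)
          (Matrix.isHermitian_mul_mul_conjTranspose U.val hC.isHermitian) ≼ₘ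
        specPtraceSum (diagEig C hC.isHermitian 1) (diagEig_isHermitian hC.isHermitian 1) := by
  obtain ⟨y, hy, hT, hmaj⟩ := exists_array_of_conj hC U
  exact (hmaj 1).2 (dominated_of_three_terms (eigSeq_antitone hC) (eigSeq_nonneg hC) hd hy hT
    fun i hi => eigSeq_eq_zero_of_rank_le hC (h.trans hi))

theorem conj_majorized_of_eig_const (hd : 2 < d) (hC : C.PosSemidef)
    (h : ∀ k, 2 ≤ k → k ≤ 2 * d - 1 → eig C hC.isHermitian k = eig C hC.isHermitian 2)
    (U : Matrix.unitaryGroup (Fin 2 × Fin d) ℂ) :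
      specPtraceSum (U.val * C * U.valᴴ)
          (Matrix.isHermitian_mul_mul_conjTranspose U.val hC.isHermitian) ≼ₘ
        specPtraceSum (diagEig C hC.isHermitian 1) (diagEig_isHermitian hC.isHermitian 1) := by
  obtain ⟨y, hy, hT, hmaj⟩ := exists_array_of_conj hC U
  exact (hmaj 1).2 (dominated_of_const_from_one (eigSeq_antitone hC) (eigSeq_nonneg hC) hd hy hT
    fun i hi hi2 => h (i + 1) (by omega) (by omega))

theorem conj_majorized_of_eig_const_from_three (hd : 2 < d) (hC : C.PosSemidef)
    (h : ∀ k, 3 ≤ k → k ≤ 2 * d - 1 → eig C hC.isHermitian k = eig C hC.isHermitian 3)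
    (h' : eig C hC.isHermitian 2 ≥
      2 * ((d : ℝ) - 2) * eig C hC.isHermitian 3 + eig C hC.isHermitian (2 * d))
    (U : Matrix.unitaryGroup (Fin 2 × Fin d) ℂ) :
      specPtraceSum (U.val * C * U.valᴴ)
          (Matrix.isHermitian_mul_mul_conjTranspose U.val hC.isHermitian) ≼ₘ
        specPtraceSum (diagEig C hC.isHermitian 1) (diagEig_isHermitian hC.isHermitian 1) ∨
      specPtraceSum (U.val * C * U.valᴴ)
          (Matrix.isHermitian_mul_mul_conjTranspose U.val hC.isHermitian) ≼ₘ
        specPtraceSum (diagEig C hC.isHermitian (transposition d hd))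
          (diagEig_isHermitian hC.isHermitian (transposition d hd)) := by
  obtain ⟨y, hy, hT, hmaj⟩ := exists_array_of_conj hC U
  rw [hmaj, hmaj]
  rw [eig_eq_eigSeq _ (show 1 ≤ 2 * d by omega)] at h'
  exact dominated_or_dominated_transposition (eigSeq_antitone hC) (eigSeq_nonneg hC) hd hy hT
    (fun i hi hi2 => h (i + 1) (by omega) (by omega)) h'

theorem conj_majorized_of_rank_eq_five (hC : C.PosSemidef) (h3 : d = 3) (h5 : C.rank = 5)
    (h : eig C hC.isHermitian 3 = eig C hC.isHermitian 4)
    (h' : eig C hC.isHermitian 4 = eig C hC.isHermitian 5)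
    (U : Matrix.unitaryGroup (Fin 2 × Fin d) ℂ) :
      specPtraceSum (U.val * C * U.valᴴ)
          (Matrix.isHermitian_mul_mul_conjTranspose U.val hC.isHermitian) ≼ₘ
        specPtraceSum (diagEig C hC.isHermitian 1) (diagEig_isHermitian hC.isHermitian 1) := by
  obtain ⟨y, hy, hT, hmaj⟩ := exists_array_of_conj hC U
  have e1 : eigSeq C hC.isHermitian 2 = eigSeq C hC.isHermitian 3 := h
  have e2 : eigSeq C hC.isHermitian 3 = eigSeq C hC.isHermitian 4 := h'
  refine (hmaj 1).2 (dominated_of_six (eigSeq_antitone hC) (eigSeq_nonneg hC) h3 hy hT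
    (b := eigSeq C hC.isHermitian 2) (fun i hi hi2 => ?_) (eigSeq_eq_zero_of_rank_le hC h5.le))
  obtain rfl | rfl | rfl : i = 2 ∨ i = 3 ∨ i = 4 := by omega
  · rfl
  · exact e1.symm
  · exact (e1.trans e2).symm

theorem spectrum_cases_of_forall_majorized (hd : 2 < d) (hC : C.PosSemidef)
    (hU : ∀ U : Matrix.unitaryGroup (Fin 2 × Fin d) ℂ, ∃ π : Equiv.Perm (Fin (2 * d)),
      specPtraceSum (U.val * C * U.valᴴ)
          (Matrix.isHermitian_mul_mul_conjTranspose U.val hC.isHermitian) ≼ₘ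
        specPtraceSum (diagEig C hC.isHermitian π) (diagEig_isHermitian hC.isHermitian π)) :
    C.rank ≤ 3 ∨
      ((C.rank = 2 * d - 1 ∨ C.rank = 2 * d) ∧
        ∀ k, 2 ≤ k → k ≤ 2 * d - 1 → eig C hC.isHermitian k = eig C hC.isHermitian 2) ∨
      ((C.rank = 2 * d - 1 ∨ C.rank = 2 * d) ∧
        (∀ k, 3 ≤ k → k ≤ 2 * d - 1 → eig C hC.isHermitian k = eig C hC.isHermitian 3) ∧
        eig C hC.isHermitian 2 ≥
          2 * ((d : ℝ) - 2) * eig C hC.isHermitian 3 + eig C hC.isHermitian (2 * d)) ∨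
      (d = 3 ∧ C.rank = 5 ∧ eig C hC.isHermitian 3 = eig C hC.isHermitian 4 ∧
        eig C hC.isHermitian 4 = eig C hC.isHermitian 5) := by
  have key := spectrum_cases_of_forall_dominated (eigSeq_antitone hC) (eigSeq_nonneg hC) hd
    (eigSeq_pos_iff hC) (by simpa using C.rank_le_card_width) fun σ s t hst δ h0 h1 => by
      obtain ⟨U, hUπ⟩ := exists_conj_of_transfer hC σ hst h0 h1
      obtain ⟨π, hπ⟩ := hU U
      exact ⟨π, hUπ π hπ⟩
  rcases key with h | ⟨h, h1 | ⟨h1, h2⟩ | h1⟩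
  · exact Or.inl h
  · refine Or.inr (Or.inl ⟨h, fun k hk hk2 => ?_⟩)
    rw [eig_eq_eigSeq _ (show 1 ≤ k by omega)]
    exact h1 (k - 1) (by omega) (by omega)
  · refine Or.inr (Or.inr (Or.inl ⟨h, fun k hk hk2 => ?_, ?_⟩))
    · rw [eig_eq_eigSeq _ (show 1 ≤ k by omega)]
      exact h1 (k - 1) (by omega) (by omega)
    · rw [eig_eq_eigSeq _ (show 1 ≤ 2 * d by omega)]
      exact h2
  · exact Or.inr (Or.inr (Or.inr h1))

end

theorem mainTheorem3 (d : ℕ) (hd : 2 < d) (C : Matrix (Fin 2 × Fin d) (Fin 2 × Fin d) ℂ)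
    (hC : C.PosSemidef) :
    -- the characterization
    ((∀ U : Matrix.unitaryGroup (Fin 2 × Fin d) ℂ, ∃ π : Equiv.Perm (Fin (2 * d)),
        specPtraceSum (U.val * C * U.valᴴ)
            (Matrix.isHermitian_mul_mul_conjTranspose U.val hC.isHermitian) ≼ₘ
          specPtraceSum (diagEig C hC.isHermitian π) (diagEig_isHermitian hC.isHermitian π)) ↔
      (C.rank ≤ 3 ∨
        ((C.rank = 2 * d - 1 ∨ C.rank = 2 * d) ∧
          ∀ k, 2 ≤ k → k ≤ 2 * d - 1 → eig C hC.isHermitian k = eig C hC.isHermitian 2) ∨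
        ((C.rank = 2 * d - 1 ∨ C.rank = 2 * d) ∧
          (∀ k, 3 ≤ k → k ≤ 2 * d - 1 → eig C hC.isHermitian k = eig C hC.isHermitian 3) ∧
          eig C hC.isHermitian 2 ≥
            2 * ((d : ℝ) - 2) * eig C hC.isHermitian 3 + eig C hC.isHermitian (2 * d)) ∨
        (d = 3 ∧ C.rank = 5 ∧ eig C hC.isHermitian 3 = eig C hC.isHermitian 4 ∧
          eig C hC.isHermitian 4 = eig C hC.isHermitian 5))) ∧
    -- the diagonal matrix in case (1)
    (C.rank ≤ 3 →
      ∀ U : Matrix.unitaryGroup (Fin 2 × Fin d) ℂ,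
        specPtraceSum (U.val * C * U.valᴴ)
            (Matrix.isHermitian_mul_mul_conjTranspose U.val hC.isHermitian) ≼ₘ
          specPtraceSum (diagEig C hC.isHermitian 1) (diagEig_isHermitian hC.isHermitian 1)) ∧
    -- the diagonal matrix in case (2)
    ((C.rank = 2 * d - 1 ∨ C.rank = 2 * d) →
      (∀ k, 2 ≤ k → k ≤ 2 * d - 1 → eig C hC.isHermitian k = eig C hC.isHermitian 2) →
      ∀ U : Matrix.unitaryGroup (Fin 2 × Fin d) ℂ,
        specPtraceSum (U.val * C * U.valᴴ)
            (Matrix.isHermitian_mul_mul_conjTranspose U.val hC.isHermitian) ≼ₘ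
          specPtraceSum (diagEig C hC.isHermitian 1) (diagEig_isHermitian hC.isHermitian 1)) ∧
    -- the diagonal matrices in case (3)
    ((C.rank = 2 * d - 1 ∨ C.rank = 2 * d) →
      (∀ k, 3 ≤ k → k ≤ 2 * d - 1 → eig C hC.isHermitian k = eig C hC.isHermitian 3) →
      eig C hC.isHermitian 2 ≥
        2 * ((d : ℝ) - 2) * eig C hC.isHermitian 3 + eig C hC.isHermitian (2 * d) →
      ∀ U : Matrix.unitaryGroup (Fin 2 × Fin d) ℂ,
        specPtraceSum (U.val * C * U.valᴴ)
            (Matrix.isHermitian_mul_mul_conjTranspose U.val hC.isHermitian) ≼ₘ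
          specPtraceSum (diagEig C hC.isHermitian 1) (diagEig_isHermitian hC.isHermitian 1) ∨
        specPtraceSum (U.val * C * U.valᴴ)
            (Matrix.isHermitian_mul_mul_conjTranspose U.val hC.isHermitian) ≼ₘ
          specPtraceSum (swapP d hd * diagEig C hC.isHermitian 1 * swapP d hd)
            (swapP_mul_mul_isHermitian hd (diagEig_isHermitian hC.isHermitian 1))) ∧
    -- the diagonal matrix in case (4)
    (d = 3 → C.rank = 5 → eig C hC.isHermitian 3 = eig C hC.isHermitian 4 →
      eig C hC.isHermitian 4 = eig C hC.isHermitian 5 →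
      ∀ U : Matrix.unitaryGroup (Fin 2 × Fin d) ℂ,
        specPtraceSum (U.val * C * U.valᴴ)
            (Matrix.isHermitian_mul_mul_conjTranspose U.val hC.isHermitian) ≼ₘ
          specPtraceSum (diagEig C hC.isHermitian 1) (diagEig_isHermitian hC.isHermitian 1)) := by
  have c1 := conj_majorized_of_rank_le_three hd hC
  have c2 := conj_majorized_of_eig_const hd hC
  have c3 := conj_majorized_of_eig_const_from_three hd hC
  have c4 := conj_majorized_of_rank_eq_five hC
  have hswap := specPtraceSum_congr
    (swapP_mul_mul_isHermitian hd (diagEig_isHermitian hC.isHermitian 1))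
    (diagEig_isHermitian hC.isHermitian (transposition d hd)) (swapP_mul_diagEig_mul_swapP hd _)
  refine ⟨⟨spectrum_cases_of_forall_majorized hd hC, fun h U => ?_⟩, c1, fun _ => c2,
    fun _ h h' U => ?_, c4⟩
  · rcases h with h | ⟨_, h⟩ | ⟨_, h, h'⟩ | ⟨h1, h2, h3, h4⟩
    · exact ⟨1, c1 h U⟩
    · exact ⟨1, c2 h U⟩
    · exact (c3 h h' U).elim (fun h => ⟨_, h⟩) fun h => ⟨_, h⟩
    · exact ⟨1, c4 h1 h2 h3 h4 U⟩
  · rw [hswap]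
    exact c3 h h' U
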